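/- Let $V=\bigoplus_{q\in\frac12\mathbb{Z}}V_{(q)}$ be a nonzero vertex operator superalgebra over $\mathbb{C}$, graded by the eigenvalues of $L(0)$, with $\dim V_{(q)}<\infty$ for all $q$ and $V_{(q)}=0$ for $q$ sufficiently negative, and with even part $\bigoplus_{n\in\mathbb{Z}}V_{(n)}$ and odd part $\bigoplus_{n\in\mathbb{Z}}V_{(n+\frac12)}$. Write $Y(u,z)=\sum_{n\in\mathbb{Z}}u_nz^{-n-1}$, and assume that $V$ is strongly generated by $V_{(3/2)}+V_{(2)}$, i.e. $V$ is linearly spanned by $\mathbf 1$ and the vectors $a^{(1)}_{-n_1}\cdots a^{(r)}_{-n_r}\mathbf 1$ with $r\ge 1$, $a^{(i)}\in V_{(3/2)}+V_{(2)}$ and $n_i\ge 1$. Call a bilinear form $\langle\cdot,\cdot\rangle$ on $V$ invariant if $$\langle Y(u,z)v,w\rangle=(-1)^{|u||v|}\left\langle v,\,Y\!\left(e^{zL(1)}z^{-2L(0)}e^{\pi i L(0)}u,\,z^{-1}\right)w\right\rangle$$ for all parity-homogeneous $u,v\in V$ and all $w\in V$, where $|\cdot|\in\{0,1\}$ is the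 parity and $e^{\pi iL(0)}u=e^{\pi i q}u$ for $u\in V_{(q)}$. An ideal is a subspace $J$ with $u_nw\in J$ and $w_nu\in J$ for all $u\in V$, $w\in J$, $n\in\mathbb{Z}$; a maximal ideal is a maximal element among the ideals different from $V$; and $V$ is simple if its only ideals are $0$ and $V$. Then there is exactly one symmetric invariant bilinear form $\langle\cdot,\cdot\rangle$ on $V$ with $\langle\mathbf 1,\mathbf 1\rangle=1$. Its kernel $\{v\in V : \langle v,w\rangle=0\text{ for all }w\in V\}$ does not contain $\mathbf 1$, is the unique maximal ideal of $V$, and contains every ideal different from $V$. Moreover, $V$ is simple if and only if this form is non-degenerate. -/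

import Mathlib

open scoped Nat

noncomputable section

/-- The mode `u_n ∈ End V` of `Y(u, z) = ∑ u_n z^{-n-1}`. A `VertexOperator ℂ V` is a linear map
`V → V((z))`, so `u_n v = 0` for `n` sufficiently large, by construction. -/
def vosaMode {V : Type*} [AddCommGroup V] [Module ℂ V]
    (Y : V →ₗ[ℂ] VertexOperator ℂ V) (u : V) (n : ℤ) : Module.End ℂ V :=
  VertexOperator.ncoeff (Y u) n

/-- For a vector `ω`, the space `V_(k/2)` of all `v` with `L(0) v = (k/2) v`, where
`L(0) = ω_1`. Weights in `(1/2)ℤ` are indexed by twice the weight. -/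
def vosaWeight {V : Type*} [AddCommGroup V] [Module ℂ V]
    (Y : V →ₗ[ℂ] VertexOperator ℂ V) (ω : V) (k : ℤ) : Submodule ℂ V :=
  Module.End.eigenspace (vosaMode Y ω 1) ((k : ℂ) / 2)

/-- The even part (`α = 0`, sum of the `V_(n)`, `n ∈ ℤ`) and the odd part (`α = 1`, sum of the
`V_(n+1/2)`, `n ∈ ℤ`) of `V`. -/
def vosaParity {V : Type*} [AddCommGroup V] [Module ℂ V]
    (Y : V →ₗ[ℂ] VertexOperator ℂ V) (ω : V) (α : ZMod 2) : Submodule ℂ V :=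
  ⨆ k : {k : ℤ // (k : ZMod 2) = α}, vosaWeight Y ω k

/-- The sign `(-1)^{αβ}` for parities `α` and `β`. -/
def koszulSign (α β : ZMod 2) : ℂ := (-1) ^ (α.val * β.val)

/-- The structure of a vertex operator superalgebra over `ℂ`, with weights in `(1/2)ℤ` and the
parity given by the weight. -/
structure VertexOperatorSuperalgebra (V : Type*) [AddCommGroup V] [Module ℂ V] where
  /-- the state-field correspondence -/
  Y : V →ₗ[ℂ] VertexOperator ℂ V
  /-- the vacuum vector -/
  vacuum : V
  /-- the conformal vector -/
  omega : V
  /-- the central charge -/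
  centralCharge : ℂ
  /-- `V` is the direct sum of the weight spaces `V_(k/2)`, `k ∈ ℤ`. -/
  isInternal : DirectSum.IsInternal (fun k : ℤ => vosaWeight Y omega k)
  finiteDimensional : ∀ k : ℤ, FiniteDimensional ℂ (vosaWeight Y omega k)
  weight_eq_bot : ∃ N : ℤ, ∀ k : ℤ, k < N → vosaWeight Y omega k = ⊥
  vacuum_even : vacuum ∈ vosaParity Y omega 0
  omega_even : omega ∈ vosaParity Y omega 0
  mode_parity : ∀ (α β : ZMod 2) (u v : V), u ∈ vosaParity Y omega α → v ∈ vosaParity Y omega β →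
    ∀ n : ℤ, vosaMode Y u n v ∈ vosaParity Y omega (α + β)
  /-- The Jacobi identity in components. Every sum has only finitely many nonzero terms. -/
  jacobi : ∀ (α β : ZMod 2) (u v : V), u ∈ vosaParity Y omega α → v ∈ vosaParity Y omega β →
    ∀ (m n k : ℤ) (w : V),
      ∑ᶠ i : ℕ, ((-1 : ℂ) ^ i * ((Ring.choose m i : ℤ) : ℂ)) •
          (vosaMode Y u (m + k - i) (vosaMode Y v (n + i) w)
            - (koszulSign α β * (-1 : ℂ) ^ m) •
              vosaMode Y v (m + n - i) (vosaMode Y u (k + i) w))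
        = ∑ᶠ i : ℕ, ((Ring.choose k i : ℤ) : ℂ) •
            vosaMode Y (vosaMode Y u (m + i) v) (n + k - i) w
  vacuum_mode : ∀ (m : ℤ) (v : V), vosaMode Y vacuum m v = if m = -1 then v else 0
  creation : ∀ v : V, vosaMode Y v (-1) vacuum = v
  creation_nonneg : ∀ (v : V) (n : ℕ), vosaMode Y v n vacuum = 0
  /-- The Virasoro relations for `L(n) = ω_{n+1}`. -/
  virasoro : ∀ m n : ℤ,
    vosaMode Y omega (m + 1) * vosaMode Y omega (n + 1)
        - vosaMode Y omega (n + 1) * vosaMode Y omega (m + 1)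
      = ((m : ℂ) - n) • vosaMode Y omega (m + n + 1)
        + (if m + n = 0 then ((m : ℂ) ^ 3 - m) / 12 * centralCharge else 0) •
          (1 : Module.End ℂ V)
  /-- `Y(L(-1)v, z) = d/dz Y(v, z)`, where `L(-1) = ω_0`. -/
  derivative : ∀ (v : V) (n : ℤ),
    vosaMode Y (vosaMode Y omega 0 v) n = (-(n : ℂ)) • vosaMode Y v (n - 1)

namespace VertexOperatorSuperalgebra

variable {V : Type*} [AddCommGroup V] [Module ℂ V] (A : VertexOperatorSuperalgebra V)

/-- The mode `u_n`. -/
def mode (u : V) (n : ℤ) : Module.End ℂ V := vosaMode A.Y u n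

/-- The Virasoro operator `L(n) = ω_{n+1}`. -/
def L (n : ℤ) : Module.End ℂ V := A.mode A.omega (n + 1)

/-- The weight space `V_(k/2)`. -/
def weight (k : ℤ) : Submodule ℂ V := vosaWeight A.Y A.omega k

/-- The even (`α = 0`) or odd (`α = 1`) part. -/
def parity (α : ZMod 2) : Submodule ℂ V := vosaParity A.Y A.omega α

/-- `V` is linearly spanned by the vectors `a⁽¹⁾_{-n₁} ⋯ a⁽ʳ⁾_{-n_r} 𝟏` with `r ≥ 0` (`r = 0`
gives `𝟏`), all `a⁽ⁱ⁾ ∈ T` and all `nᵢ ≥ 1`. -/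
def StronglyGenerated (T : Set V) : Prop :=
  Submodule.span ℂ {x : V | ∃ l : List (V × ℕ), (∀ p ∈ l, p.1 ∈ T ∧ 1 ≤ p.2) ∧
    x = l.foldr (fun p y => A.mode p.1 (-(p.2 : ℤ)) y) A.vacuum} = ⊤

/-- A (two-sided) ideal. -/
structure IsIdeal (J : Submodule ℂ V) : Prop where
  mode_right : ∀ (u w : V) (n : ℤ), w ∈ J → A.mode u n w ∈ J
  mode_left : ∀ (u w : V) (n : ℤ), w ∈ J → A.mode w n u ∈ J

/-- A maximal ideal: maximal among the proper ideals. -/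
def IsMaximalIdeal (J : Submodule ℂ V) : Prop :=
  A.IsIdeal J ∧ J ≠ ⊤ ∧ ∀ K : Submodule ℂ V, A.IsIdeal K → J < K → K = ⊤

/-- Simplicity: `V ≠ 0`, and the only ideals are `0` and `V`. -/
def IsSimple : Prop :=
  Nontrivial V ∧ ∀ J : Submodule ℂ V, A.IsIdeal J → J = ⊥ ∨ J = ⊤

/-- For `u` of weight `q = k/2`, the coefficient of `z^{-n-1}` in
`Y(e^{zL(1)} z^{-2L(0)} e^{πiL(0)} u, z⁻¹)`. Indeed
`e^{zL(1)} z^{-2L(0)} e^{πiL(0)} u = e^{πiq} ∑_j z^{j-k} L(1)^j u / j!` (a finite sum) and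
`Y(x, z⁻¹) = ∑_m x_m z^{m+1}`, so that `m = k - j - n - 2`. -/
def oppositeMode (k : ℤ) (u : V) (n : ℤ) : Module.End ℂ V :=
  Complex.exp (Real.pi * Complex.I * ((k : ℂ) / 2)) •
    ∑ᶠ j : ℕ, ((j ! : ℂ)⁻¹) • A.mode ((A.L 1 ^ j) u) (k - j - n - 2)

/-- Invariance of a bilinear form:
`⟨Y(u,z)v, w⟩ = (-1)^{|u||v|} ⟨v, Y(e^{zL(1)} z^{-2L(0)} e^{πiL(0)} u, z⁻¹) w⟩`,
coefficientwise, for `u` of weight `k/2` (hence of parity `k` mod 2), `v` of parity `β`, and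
any `w`. -/
def IsInvariant (B : LinearMap.BilinForm ℂ V) : Prop :=
  ∀ (k : ℤ) (β : ZMod 2) (u v w : V) (n : ℤ), u ∈ A.weight k → v ∈ A.parity β →
    B (A.mode u n v) w = koszulSign (k : ZMod 2) β * B v (A.oppositeMode k u n w)

end VertexOperatorSuperalgebra

end

/-! ### Signs, powers of `I`, binomial sums -/

noncomputable section

/-! Strong generation leaves only the weights 0, 3/2, 2, ..., with the vacuum spanning weight zero
(`StronglyGenerated.isCFTType`). Let ε be the projection onto weight zero, read as a functional, and
let u'_n be the opposite modes. Invariance applied to u = u_{-1}𝟏 forces ⟨u, w⟩ = ⟨𝟏, u'_{-1} w⟩,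
and symmetry with the normalization forces ⟨𝟏, ·⟩ = ε. This gives uniqueness
(`IsVacuumForm.eq_of_isInvariant`).

For existence, ⟨u, w⟩ = ε(u'_{-1} w) is taken as the definition. Since L(1) kills weight one, ε
vanishes on the images of L(1) and L(-1), which makes these two operators adjoint to each other. By
sl₂-theory V is spanned by the vacuum and the strings L(-1)^j p with p quasi-primary of positive
weight. Symmetry and invariance are checked on quasi-primary vectors and carried along the strings
(`weight_le_of_L_neg_one`). For three quasi-primary vectors, L(1) determines the numbers ε(v_a u_b
w) up to one scalar (`three_point`); the iterate formula then turns invariance into a binomial sum,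
which Vandermonde's identity evaluates to 1.

An ideal is stable under L(0), hence graded. A proper one has no part of weight zero, so ε vanishes
on it and the formula puts it inside the kernel. The kernel is an ideal by invariance, so it is the
largest proper ideal; maximality and the simplicity criterion follow formally. -/

theorem koszulSign_zero_left (β : ZMod 2) : koszulSign 0 β = 1 := by
  simp [koszulSign]

theorem koszulSign_zero_right (α : ZMod 2) : koszulSign α 0 = 1 := by
  simp [koszulSign]

theorem koszulSign_comm (α β : ZMod 2) : koszulSign α β = koszulSign β α := by
  simp [koszulSign, mul_comm]

theorem koszulSign_add_right (α β γ : ZMod 2) :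
    koszulSign α (β + γ) = koszulSign α β * koszulSign α γ := by
  have h : ∀ a b c : ZMod 2,
      Even (a.val * (b + c).val) ↔ Even (a.val * b.val + a.val * c.val) := by decide
  rw [koszulSign, koszulSign, koszulSign, ← pow_add]
  rcases Nat.even_or_odd (α.val * (β + γ).val) with h1 | h1
  · rw [h1.neg_one_pow, ((h α β γ).1 h1).neg_one_pow]
  · rw [h1.neg_one_pow,
      (Nat.not_even_iff_odd.1 fun h2 => Nat.not_even_iff_odd.2 h1 ((h α β γ).2 h2)).neg_one_pow]

theorem koszulSign_mul_self (α β : ZMod 2) : koszulSign α β * koszulSign α β = 1 := by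
  rw [koszulSign, ← pow_add, ← two_mul]
  simp

theorem koszulSign_intCast_self (k : ℤ) : koszulSign (k : ZMod 2) (k : ZMod 2) = (-1) ^ k := by
  rcases Int.even_or_odd k with h | h
  · have : (k : ZMod 2) = 0 := by
      rw [ZMod.intCast_zmod_eq_zero_iff_dvd]; exact_mod_cast h.two_dvd
    rw [this, h.neg_one_zpow]; simp [koszulSign]
  · have : (k : ZMod 2) = 1 := by
      obtain ⟨j, rfl⟩ := h
      push_cast
      rw [show (2 : ZMod 2) = 0 from rfl]; simp
    rw [this, h.neg_one_zpow, koszulSign, show (1 : ZMod 2).val = 1 from rfl]; simp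

theorem exp_pi_mul_I_half (k : ℤ) :
    Complex.exp (Real.pi * Complex.I * ((k : ℂ) / 2)) = Complex.I ^ k := by
  rw [show (Real.pi * Complex.I * ((k : ℂ) / 2) : ℂ) = k * (Real.pi / 2 * Complex.I) by ring,
    Complex.exp_int_mul, Complex.exp_pi_div_two_mul_I]

/-- Finite sums against binomial coefficients of a natural number. -/
theorem finsum_choose_natCast_smul {M : Type*} [AddCommGroup M] [Module ℂ M] (m : ℕ) (f : ℕ → M) :
    ∑ᶠ i : ℕ, ((Ring.choose (m : ℤ) i : ℤ) : ℂ) • f i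
      = ∑ i ∈ Finset.range (m + 1), (m.choose i : ℂ) • f i := by
  rw [finsum_eq_sum_of_support_subset (s := Finset.range (m + 1))]
  · simp [Ring.choose_natCast]
  · intro i hi
    rw [Function.mem_support] at hi
    by_contra h
    apply hi
    rw [Ring.choose_natCast, Nat.choose_eq_zero_of_lt (by simpa using h)]
    simp

/-! ### Consequences of the Jacobi identity, and the action of L(-1), L(0), L(1) -/

namespace VertexOperatorSuperalgebra

variable {V : Type*} [AddCommGroup V] [Module ℂ V] (A : VertexOperatorSuperalgebra V)

theorem mem_weight {k : ℤ} {v : V} : v ∈ A.weight k ↔ A.L 0 v = ((k : ℂ) / 2) • v :=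
  Module.End.mem_eigenspace_iff

theorem weight_le_parity (k : ℤ) : A.weight k ≤ A.parity (k : ZMod 2) :=
  le_iSup (fun j : {j : ℤ // (j : ZMod 2) = (k : ZMod 2)} => vosaWeight A.Y A.omega j) ⟨k, rfl⟩

theorem iSup_weight : ⨆ k, A.weight k = ⊤ :=
  A.isInternal.submodule_iSup_eq_top

/-- A subspace containing all homogeneous vectors is everything. -/
theorem mem_of_weight_le {S : Submodule ℂ V} (h : ∀ k, A.weight k ≤ S) (v : V) : v ∈ S := by
  have : (⊤ : Submodule ℂ V) ≤ S := by
    rw [← A.iSup_weight]; exact iSup_le h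
  exact this trivial

/-- Linear maps may be prescribed on the weight spaces. -/
theorem exists_linearMap_of_weight {M : Type*} [AddCommGroup M] [Module ℂ M]
    (f : ℤ → V →ₗ[ℂ] M) :
    ∃ F : V →ₗ[ℂ] M, ∀ k, ∀ v ∈ A.weight k, F v = f k v := by
  classical
  let e := LinearEquiv.ofBijective
    (DirectSum.coeLinearMap fun k : ℤ => vosaWeight A.Y A.omega k) A.isInternal
  refine ⟨DirectSum.toModule ℂ ℤ M (fun k => (f k).comp (vosaWeight A.Y A.omega k).subtype) ∘ₗ
    e.symm.toLinearMap, fun k v hv => ?_⟩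
  have : e.symm v = DirectSum.lof ℂ ℤ (fun k : ℤ => vosaWeight A.Y A.omega k) k ⟨v, hv⟩ := by
    rw [LinearEquiv.symm_apply_eq]
    exact (DirectSum.coeLinearMap_lof (fun k : ℤ => vosaWeight A.Y A.omega k) k ⟨v, hv⟩).symm
  simp [this]

theorem mode_add (u v : V) (n : ℤ) : A.mode (u + v) n = A.mode u n + A.mode v n := by
  simp [mode, vosaMode]

theorem mode_smul (c : ℂ) (u : V) (n : ℤ) : A.mode (c • u) n = c • A.mode u n := by
  simp [mode, vosaMode]

theorem mode_zero (n : ℤ) : A.mode 0 n = 0 := by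
  simp [mode, vosaMode]

/-- The linear map `u ↦ u_n`. -/
def modeLinear (n : ℤ) : V →ₗ[ℂ] Module.End ℂ V where
  toFun u := A.mode u n
  map_add' u v := A.mode_add u v n
  map_smul' c u := A.mode_smul c u n

theorem modeLinear_apply (u : V) (n : ℤ) : A.modeLinear n u = A.mode u n := rfl

theorem vacuum_mode' (m : ℤ) (v : V) : A.mode A.vacuum m v = if m = -1 then v else 0 :=
  A.vacuum_mode m v

theorem creation' (v : V) : A.mode v (-1) A.vacuum = v := A.creation v

theorem mode_vacuum_of_nonneg (v : V) {n : ℤ} (hn : 0 ≤ n) : A.mode v n A.vacuum = 0 := by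
  lift n to ℕ using hn
  exact A.creation_nonneg v n

theorem mode_L_neg_one (v : V) (n : ℤ) :
    A.mode (A.L (-1) v) n = (-(n : ℂ)) • A.mode v (n - 1) :=
  A.derivative v n

/-- The commutator formula. -/
theorem commutator {α β : ZMod 2} {u v : V} (hu : u ∈ A.parity α) (hv : v ∈ A.parity β)
    (m : ℕ) (n : ℤ) (w : V) :
    A.mode u m (A.mode v n w) - koszulSign α β • A.mode v n (A.mode u m w)
      = ∑ i ∈ Finset.range (m + 1), (m.choose i : ℂ) • A.mode (A.mode u i v) (n + m - i) w := by
  have h := A.jacobi α β u v hu hv 0 n m w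
  rw [finsum_choose_natCast_smul m (fun i => vosaMode A.Y (vosaMode A.Y u (0 + i) v) (n + m - i) w),
    finsum_eq_single _ 0] at h
  · simpa [mode] using h
  · intro i hi
    rw [Ring.choose_zero_pos ℤ (Nat.pos_of_ne_zero hi)]
    simp

/-- The associativity (iterate) formula. -/
theorem iterate {α β : ZMod 2} {u v : V} (hu : u ∈ A.parity α) (hv : v ∈ A.parity β)
    (m n : ℤ) (w : V) :
    A.mode (A.mode u m v) n w = ∑ᶠ i : ℕ, ((-1 : ℂ) ^ i * ((Ring.choose m i : ℤ) : ℂ)) •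
      (A.mode u (m - i) (A.mode v (n + i) w)
        - (koszulSign α β * (-1 : ℂ) ^ m) • A.mode v (m + n - i) (A.mode u i w)) := by
  have h := A.jacobi α β u v hu hv m n 0 w
  rw [finsum_eq_single (fun i : ℕ => ((Ring.choose (0 : ℤ) i : ℤ) : ℂ) • _) 0] at h
  · simpa [mode] using h.symm
  · intro i hi
    rw [Ring.choose_zero_pos ℤ (Nat.pos_of_ne_zero hi)]
    simp

/-- Skew-symmetry, in the form of an expansion in creation modes. -/
theorem skew {α β : ZMod 2} {u v : V} (hu : u ∈ A.parity α) (hv : v ∈ A.parity β) (m : ℤ) :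
    A.mode u m v = -(koszulSign α β * (-1 : ℂ) ^ m) •
      ∑ᶠ i : ℕ, ((Ring.choose (-1 : ℤ) i : ℤ) : ℂ) •
        A.mode (A.mode v (m + i) u) (-1 - i) A.vacuum := by
  -- Both left-hand sides are built from the same products u_{m-i} v_{i-1} 𝟏 and v_{m-1-i} u_i 𝟏;
  -- they differ by the factor -(±1)(-1)^m, where the sign squares to 1.
  have h1 := A.jacobi α β u v hu hv m (-1) 0 A.vacuum
  have h2 := A.jacobi β α v u hv hu m 0 (-1) A.vacuum
  rw [finsum_eq_single (fun i : ℕ => ((Ring.choose (0 : ℤ) i : ℤ) : ℂ) • _) 0] at h1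
  · simp only [Nat.cast_zero, Ring.choose_zero_right, add_zero, sub_zero, Int.cast_one,
      one_smul] at h1
    rw [show vosaMode A.Y (vosaMode A.Y u m v) (-1) A.vacuum = A.mode u m v from A.creation _]
      at h1
    rw [← h1]
    have h3 : (∑ᶠ i : ℕ, ((Ring.choose (-1 : ℤ) i : ℤ) : ℂ) •
        A.mode (A.mode v (m + i) u) (-1 - i) A.vacuum) = ∑ᶠ i : ℕ,
          ((Ring.choose (-1 : ℤ) i : ℤ) : ℂ) • vosaMode A.Y (vosaMode A.Y v (m + i) u)
            (0 + -1 - i) A.vacuum := by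
      simp [mode]
    rw [h3, ← h2, smul_finsum]
    refine finsum_congr fun i => ?_
    have h4 : (koszulSign α β * (-1 : ℂ) ^ m) * (koszulSign α β * (-1 : ℂ) ^ m) = 1 := by
      have h5 : (-1 : ℂ) ^ m * (-1 : ℂ) ^ m = 1 := by
        rw [← mul_zpow]; simp
      linear_combination ((-1 : ℂ) ^ m * (-1 : ℂ) ^ m) * koszulSign_mul_self α β + h5
    rw [koszulSign_comm β α]
    generalize koszulSign α β * (-1 : ℂ) ^ m = c at h4 ⊢
    simp only [zero_add, add_zero]
    match_scalars
    · linear_combination (-(-1) ^ i * ((Ring.choose m i : ℤ) : ℂ)) * h4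
    · ring
  · intro i hi
    rw [Ring.choose_zero_pos ℤ (Nat.pos_of_ne_zero hi)]
    simp

theorem omega_mem_parity : A.omega ∈ A.parity 0 := A.omega_even

theorem L_eq_mode (n : ℤ) : A.L n = A.mode A.omega (n + 1) := rfl

/-- `[L(-1), v_n] = -n v_{n-1}`. -/
theorem L_neg_one_mode {b : ℤ} {v : V} (hv : v ∈ A.weight b) (n : ℤ) (w : V) :
    A.L (-1) (A.mode v n w) = A.mode v n (A.L (-1) w) - (n : ℂ) • A.mode v (n - 1) w := by
  have h := A.commutator A.omega_mem_parity (A.weight_le_parity b hv) 0 n w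
  have h2 := congrArg (fun f => f w) (A.mode_L_neg_one v n)
  simp [koszulSign_zero_left, L_eq_mode] at h h2 ⊢
  rw [h2] at h
  rw [sub_eq_iff_eq_add] at h
  rw [h]; abel

/-- `[L(0), v_n] = (wt v - n - 1) v_n`. -/
theorem L_zero_mode {b : ℤ} {v : V} (hv : v ∈ A.weight b) (n : ℤ) (w : V) :
    A.L 0 (A.mode v n w) = A.mode v n (A.L 0 w) + ((b : ℂ) / 2 - n - 1) • A.mode v n w := by
  have h := A.commutator A.omega_mem_parity (A.weight_le_parity b hv) 1 n w
  have h2 := congrArg (fun f => f w) (A.mode_L_neg_one v (n + 1))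
  have h3 := A.mem_weight.1 hv
  simp [koszulSign_zero_left, L_eq_mode, Finset.sum_range_succ] at h h2 h3 ⊢
  rw [h2, h3, mode_smul, sub_eq_iff_eq_add] at h
  rw [h, LinearMap.smul_apply]
  module

/-- `[L(1), v_n] = (L(1) v)_n + (2 wt v - n - 2) v_{n+1}`. -/
theorem L_one_mode {b : ℤ} {v : V} (hv : v ∈ A.weight b) (n : ℤ) (w : V) :
    A.L 1 (A.mode v n w) = A.mode v n (A.L 1 w) + ((b : ℂ) - 2 - n) • A.mode v (n + 1) w
      + A.mode (A.L 1 v) n w := by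
  have h := A.commutator A.omega_mem_parity (A.weight_le_parity b hv) 2 n w
  have h2 := congrArg (fun f => f w) (A.mode_L_neg_one v (n + 2))
  have h3 := A.mem_weight.1 hv
  simp [koszulSign_zero_left, L_eq_mode, Finset.sum_range_succ] at h h2 h3 ⊢
  rw [h2, h3, mode_smul, sub_eq_iff_eq_add] at h
  rw [h, LinearMap.smul_apply, show n + 2 - 1 = n + 1 by ring]
  module

theorem vacuum_mem_weight : A.vacuum ∈ A.weight 0 := by
  rw [mem_weight, L_eq_mode, A.mode_vacuum_of_nonneg _ (by norm_num)]
  simp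

theorem mode_mem_weight {a b : ℤ} {u v : V} (hu : u ∈ A.weight a) (hv : v ∈ A.weight b) (n : ℤ) :
    A.mode u n v ∈ A.weight (a + b - 2 * n - 2) := by
  rw [mem_weight, A.L_zero_mode hu, A.mem_weight.1 hv, map_smul, ← add_smul]
  congr 1
  push_cast
  ring

/-- `[L(m), L(n)] = (m - n) L(m + n)` in the cases without central term. -/
theorem L_comm {m n : ℤ} (h : m + n ≠ 0 ∨ m ^ 3 = m) (v : V) :
    A.L m (A.L n v) = A.L n (A.L m v) + ((m : ℂ) - n) • A.L (m + n) v := by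
  have h1 := congrArg (fun f => f v) (A.virasoro m n)
  have h2 : (if m + n = 0 then ((m : ℂ) ^ 3 - m) / 12 * A.centralCharge else 0) = 0 := by
    split_ifs with h0
    · rcases h with h | h
      · exact absurd h0 h
      · have : (m : ℂ) ^ 3 = m := by exact_mod_cast h
        rw [this]; simp
    · rfl
  rw [h2] at h1
  simp only [LinearMap.sub_apply, Module.End.mul_apply, LinearMap.smul_apply,
    zero_smul, add_zero, sub_eq_iff_eq_add] at h1
  rw [add_comm]
  exact h1

theorem L_mem_weight {k : ℤ} {v : V} (n : ℤ) (hn : n ≠ 0) (hv : v ∈ A.weight k) :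
    A.L n v ∈ A.weight (k - 2 * n) := by
  rw [mem_weight, A.L_comm (Or.inl (by simpa using hn)), A.mem_weight.1 hv, map_smul, zero_add,
    ← add_smul]
  congr 1
  push_cast
  ring

theorem L_one_pow_mem_weight {k : ℤ} {v : V} (hv : v ∈ A.weight k) (j : ℕ) :
    (A.L 1 ^ j) v ∈ A.weight (k - 2 * j) := by
  induction j with
  | zero => simpa using hv
  | succ j ih =>
    rw [pow_succ', Module.End.mul_apply]
    have := A.L_mem_weight 1 one_ne_zero ih
    rwa [show k - 2 * (j : ℤ) - 2 * 1 = k - 2 * ((j + 1 : ℕ) : ℤ) by push_cast; ring] at this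

theorem L_one_L_neg_one {k : ℤ} {v : V} (hv : v ∈ A.weight k) :
    A.L 1 (A.L (-1) v) = A.L (-1) (A.L 1 v) + (k : ℂ) • v := by
  rw [A.L_comm (Or.inr (by norm_num))]
  norm_num
  rw [A.mem_weight.1 hv, smul_smul]
  congr 1
  ring

/-- `L(1)^{j+1} L(-1) v` for homogeneous `v`. -/
theorem L_one_pow_L_neg_one {k : ℤ} {v : V} (hv : v ∈ A.weight k) (j : ℕ) :
    (A.L 1 ^ (j + 1)) (A.L (-1) v)
      = A.L (-1) ((A.L 1 ^ (j + 1)) v) + ((j + 1 : ℂ) * (k - j)) • (A.L 1 ^ j) v := by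
  induction j with
  | zero => simpa using A.L_one_L_neg_one hv
  | succ j ih =>
    rw [pow_succ', Module.End.mul_apply, ih, map_add, map_smul,
      A.L_one_L_neg_one (A.L_one_pow_mem_weight hv (j + 1)),
      ← Module.End.mul_apply (A.L 1) (A.L 1 ^ (j + 1)), ← Module.End.mul_apply (A.L 1) (A.L 1 ^ j),
      ← pow_succ', ← pow_succ']
    push_cast
    module

/-- A vector is quasi-primary if `L(1)` annihilates it. For a quasi-primary vector `p`, `L(1)` acts
on the string through `p` by scalars. -/
theorem L_one_L_neg_one_pow {k : ℤ} {p : V} (hp : p ∈ A.weight k) (hp1 : A.L 1 p = 0) (j : ℕ) :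
    (A.L (-1) ^ j) p ∈ A.weight (k + 2 * j) ∧ A.L 1 ((A.L (-1) ^ (j + 1)) p)
      = ((j + 1 : ℂ) * (k + j)) • (A.L (-1) ^ j) p := by
  induction j with
  | zero => exact ⟨by simpa using hp, by simpa [hp1] using A.L_one_L_neg_one hp⟩
  | succ j ih =>
    have h := A.L_mem_weight (-1) (by norm_num) ih.1
    rw [show k + 2 * (j : ℤ) - 2 * -1 = k + 2 * ((j + 1 : ℕ) : ℤ) by push_cast; ring,
      ← Module.End.mul_apply, ← pow_succ'] at h
    refine ⟨h, ?_⟩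
    rw [pow_succ', Module.End.mul_apply, A.L_one_L_neg_one h, ih.2, map_smul,
      ← Module.End.mul_apply, ← pow_succ']
    push_cast
    module

end VertexOperatorSuperalgebra

/-! ### CFT type, and strings of quasi-primary vectors -/

namespace VertexOperatorSuperalgebra

variable {V : Type*} [AddCommGroup V] [Module ℂ V] (A : VertexOperatorSuperalgebra V)

/-- The weights are non-negative, the vacuum spans the weight-zero space, and `L(1)` annihilates
the space of weight one. -/
structure IsCFTType : Prop where
  weight_neg : ∀ k < 0, A.weight k = ⊥
  weight_zero : A.weight 0 = Submodule.span ℂ {A.vacuum}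
  L_one_eq_zero : ∀ v ∈ A.weight 2, A.L 1 v = 0

/-- A projection onto the weight-zero space, read as a linear functional. -/
structure IsVacuumFunctional (ε : V →ₗ[ℂ] ℂ) : Prop where
  vacuum : ε A.vacuum = 1
  eq_zero : ∀ k ≠ 0, ∀ v ∈ A.weight k, ε v = 0

theorem vacuum_ne_zero [Nontrivial V] : A.vacuum ≠ 0 := by
  obtain ⟨v, hv⟩ := exists_ne (0 : V)
  intro h
  apply hv
  rw [← A.creation' v, h, map_zero]

theorem exists_isVacuumFunctional [Nontrivial V] : ∃ ε, A.IsVacuumFunctional ε := by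
  classical
  obtain ⟨g, hg⟩ := Module.Projective.exists_dual_eq_one ℂ A.vacuum_ne_zero
  obtain ⟨ε, hε⟩ := A.exists_linearMap_of_weight fun k => if k = 0 then g else 0
  refine ⟨ε, ?_, fun k hk v hv => ?_⟩
  · rw [hε 0 _ A.vacuum_mem_weight, if_pos rfl, hg]
  · rw [hε k v hv, if_neg hk, LinearMap.zero_apply]

theorem L_one_vacuum : A.L 1 A.vacuum = 0 := by
  rw [L_eq_mode, A.mode_vacuum_of_nonneg _ (by norm_num)]

theorem L_one_pow_eq_zero {A : VertexOperatorSuperalgebra V} (hA : A.IsCFTType) {k : ℤ} {v : V}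
    (hv : v ∈ A.weight k) {j : ℕ} (hj : k < 2 * j) : (A.L 1 ^ j) v = 0 := by
  have h := A.L_one_pow_mem_weight hv j
  rw [hA.weight_neg _ (by linarith)] at h
  simpa using h

/-- On a string of positive weight, L(1)L(-1) acts by the nonzero scalars (j + 1)(h + j), where h is
twice the weight of p. So L(1)v, in the span of strings by induction, equals L(1)L(-1)x for some x
in that span, and v - L(-1)x is quasi-primary. `N` only drives the induction. -/
theorem weight_le_span_strings {A : VertexOperatorSuperalgebra V} (hA : A.IsCFTType) (N : ℕ) :
    ∀ k : ℤ, 0 < k → k < N → A.weight k ≤ Submodule.span ℂ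
      {x | ∃ (h : ℤ) (p : V) (j : ℕ), 0 < h ∧ h + 2 * j = k ∧ p ∈ A.weight h ∧ A.L 1 p = 0 ∧
        x = (A.L (-1) ^ j) p} := by
  induction N with
  | zero => intro k h1 h2; simp at h2; omega
  | succ N ih =>
    intro k hk hkN v hv
    have hprim : ∀ w ∈ A.weight k, A.L 1 w = 0 → w ∈ Submodule.span ℂ
      {x | ∃ (h : ℤ) (p : V) (j : ℕ), 0 < h ∧ h + 2 * j = k ∧ p ∈ A.weight h ∧ A.L 1 p = 0 ∧
        x = (A.L (-1) ^ j) p} := fun w hw hw1 =>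
      Submodule.subset_span ⟨k, w, 0, hk, by simp, hw, hw1, by simp⟩
    have h1 := A.L_mem_weight 1 one_ne_zero hv
    rcases lt_or_ge 2 k with h2 | h2
    · have h3 := ih (k - 2 * 1) (by linarith) (by push_cast at hkN; linarith) h1
      have h4 : ∃ x ∈ A.weight (k - 2) ⊓ (Submodule.span ℂ
          {x | ∃ (h : ℤ) (p : V) (j : ℕ), 0 < h ∧ h + 2 * j = k ∧ p ∈ A.weight h ∧ A.L 1 p = 0 ∧
            x = (A.L (-1) ^ j) p}).comap (A.L (-1)), A.L 1 (A.L (-1) x) = A.L 1 v := by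
        have h5 : A.L 1 v ∈ (A.weight (k - 2) ⊓ (Submodule.span ℂ
          {x | ∃ (h : ℤ) (p : V) (j : ℕ), 0 < h ∧ h + 2 * j = k ∧ p ∈ A.weight h ∧ A.L 1 p = 0 ∧
            x = (A.L (-1) ^ j) p}).comap (A.L (-1))).map (A.L 1 ∘ₗ A.L (-1)) := by
          refine Submodule.span_le.2 ?_ h3
          rintro _ ⟨h, p, j, hh, hhj, hp, hp1, rfl⟩
          have h6 := A.L_one_L_neg_one_pow hp hp1 j
          have h7 : ((j + 1 : ℂ) * (h + j)) ≠ 0 := by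
            have h8 : (((j + 1 : ℤ) * (h + j) : ℤ) : ℂ) ≠ 0 := by
              rw [Int.cast_ne_zero]
              have : 0 < (j + 1 : ℤ) * (h + j) := by positivity
              exact this.ne'
            simpa using h8
          refine ⟨((j + 1 : ℂ) * (h + j))⁻¹ • (A.L (-1) ^ j) p, ⟨?_, ?_⟩, ?_⟩
          · refine Submodule.smul_mem _ _ ?_
            rw [show k - 2 = h + 2 * j by linarith]
            exact h6.1
          · refine Submodule.smul_mem _ _ ?_
            refine Submodule.subset_span ⟨h, p, j + 1, hh, by push_cast; linarith, hp, hp1, ?_⟩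
            rw [pow_succ', Module.End.mul_apply]
          · rw [LinearMap.comp_apply, map_smul, map_smul, ← Module.End.mul_apply (A.L (-1)),
              ← pow_succ', h6.2, smul_smul, inv_mul_cancel₀ h7, one_smul]
        simpa using h5
      obtain ⟨x, ⟨hx1, hx2⟩, hx3⟩ := h4
      have h5 := A.L_mem_weight (-1) (by norm_num) hx1
      rw [show k - 2 - 2 * -1 = k by ring] at h5
      have h6 := hprim (v - A.L (-1) x) (sub_mem hv h5) (by rw [map_sub, hx3, sub_self])
      simpa using add_mem h6 (show A.L (-1) x ∈ _ from hx2)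
    -- In weights 1/2 and 1 every vector is quasi-primary: L(1) lands in negative weight, or
    -- vanishes by assumption.
    · refine hprim v hv ?_
      rcases h2.eq_or_lt with rfl | h2
      · exact hA.L_one_eq_zero v hv
      · rw [hA.weight_neg _ (by linarith)] at h1
        simpa using h1

/-- Induction along `L(-1)`-strings of quasi-primary vectors. -/
theorem weight_le_of_L_neg_one {A : VertexOperatorSuperalgebra V} (hA : A.IsCFTType)
    {S : ℤ → Submodule ℂ V}
    (hp : ∀ k, ∀ p ∈ A.weight k, A.L 1 p = 0 → p ∈ S k)
    (hL : ∀ k, ∀ v ∈ A.weight k, v ∈ S k → A.L (-1) v ∈ S (k + 2)) (k : ℤ) :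
    A.weight k ≤ S k := by
  rcases lt_trichotomy k 0 with hk | rfl | hk
  · rw [hA.weight_neg k hk]; exact bot_le
  · rw [hA.weight_zero, Submodule.span_singleton_le_iff_mem]
    exact hp 0 _ A.vacuum_mem_weight A.L_one_vacuum
  · refine (weight_le_span_strings hA (k.toNat + 1) k hk (by simp)).trans
      (Submodule.span_le.2 ?_)
    rintro _ ⟨h, p, j, -, rfl, hpw, hp1, rfl⟩
    clear hk
    induction j with
    | zero => simpa using hp h p hpw hp1
    | succ j ih =>
      rw [pow_succ', Module.End.mul_apply]
      have := hL _ _ (A.L_one_L_neg_one_pow hpw hp1 j).1 ih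
      rwa [show h + 2 * (j : ℤ) + 2 = h + 2 * ((j + 1 : ℕ) : ℤ) by push_cast; ring] at this

/-- Strong generation by vectors of weights `3/2` and `2` leaves, besides the multiples of the
vacuum, only vectors of weights at least `3/2`. -/
theorem StronglyGenerated.span_vacuum_sup_iSup_weight
    {A : VertexOperatorSuperalgebra V}
    (hA : A.StronglyGenerated ((A.weight 3 ⊔ A.weight 4 : Submodule ℂ V) : Set V)) :
    Submodule.span ℂ {A.vacuum} ⊔ ⨆ k : {k : ℤ // 3 ≤ k}, A.weight k = ⊤ := by
  refine top_le_iff.1 (hA.symm.le.trans (Submodule.span_le.2 ?_))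
  rintro _ ⟨l, hl, rfl⟩
  have hmem : ∀ k : ℤ, 3 ≤ k → A.weight k ≤ ⨆ k : {k : ℤ // 3 ≤ k}, A.weight k := fun k hk =>
    le_iSup (fun k : {k : ℤ // 3 ≤ k} => A.weight k) ⟨k, hk⟩
  induction l with
  | nil => exact Submodule.mem_sup_left (Submodule.mem_span_singleton_self _)
  | cons p l ih =>
    have ih := ih fun q hq => hl q (List.mem_cons_of_mem _ hq)
    obtain ⟨hp1, hp2⟩ := hl p List.mem_cons_self
    rw [List.foldr_cons]
    generalize l.foldr (fun p y => A.mode p.1 (-(p.2 : ℤ)) y) A.vacuum = x at ih ⊢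
    refine Submodule.mem_sup_right ?_
    obtain ⟨a, ha, b, hb, hab⟩ := Submodule.mem_sup.1 hp1
    rw [← hab, mode_add, LinearMap.add_apply]
    have key : ∀ c : ℤ, 3 ≤ c → ∀ a ∈ A.weight c,
        A.mode a (-(p.2 : ℤ)) x ∈ ⨆ k : {k : ℤ // 3 ≤ k}, A.weight k := by
      intro c hc a ha
      suffices h : Submodule.span ℂ {A.vacuum} ⊔ ⨆ k : {k : ℤ // 3 ≤ k}, A.weight k ≤
          (⨆ k : {k : ℤ // 3 ≤ k}, A.weight k).comap (A.mode a (-(p.2 : ℤ))) from h ih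
      refine sup_le ?_ (iSup_le fun k x hx => ?_)
      · rw [Submodule.span_singleton_le_iff_mem]
        exact hmem _ (by omega) (A.mode_mem_weight ha A.vacuum_mem_weight _)
      · exact hmem _ (by have := k.2; omega) (A.mode_mem_weight ha hx _)
    exact add_mem (key 3 le_rfl a ha) (key 4 (by norm_num) b hb)

/-- Projecting the decomposition of V to a single weight shows that weights 1/2 and 1 do not occur;
the condition on L(1) is then vacuous. -/
theorem StronglyGenerated.isCFTType {A : VertexOperatorSuperalgebra V}
    (hA : A.StronglyGenerated ((A.weight 3 ⊔ A.weight 4 : Submodule ℂ V) : Set V)) :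
    A.IsCFTType := by
  classical
  have hproj : ∀ k : ℤ, ∃ F : V →ₗ[ℂ] V, (∀ v ∈ A.weight k, F v = v) ∧
      ∀ l ≠ k, ∀ v ∈ A.weight l, F v = 0 := by
    intro k
    obtain ⟨F, hF⟩ := A.exists_linearMap_of_weight fun l => if l = k then LinearMap.id else 0
    refine ⟨F, fun v hv => ?_, fun l hl v hv => ?_⟩
    · rw [hF k v hv, if_pos rfl, LinearMap.id_apply]
    · rw [hF l v hv, if_neg hl, LinearMap.zero_apply]
  have hspan := hA.span_vacuum_sup_iSup_weight
  have hbot : ∀ k : ℤ, k < 3 → k ≠ 0 → A.weight k = ⊥ := by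
    intro k hk hk0
    obtain ⟨F, hF1, hF2⟩ := hproj k
    have h : ⊤ ≤ LinearMap.ker F := by
      rw [← hspan]
      refine sup_le ?_ (iSup_le fun l x hx => hF2 l (by have := l.2; omega) x hx)
      rw [Submodule.span_singleton_le_iff_mem]
      exact hF2 0 hk0.symm _ A.vacuum_mem_weight
    refine (Submodule.eq_bot_iff _).2 fun v hv => ?_
    rw [← hF1 v hv]
    exact h trivial
  refine ⟨fun k hk => hbot k (by omega) hk.ne, le_antisymm ?_ ?_, fun v hv => ?_⟩
  · obtain ⟨F, hF1, hF2⟩ := hproj 0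
    have h : ⊤ ≤ (Submodule.span ℂ {A.vacuum}).comap F := by
      rw [← hspan]
      refine sup_le ?_ (iSup_le fun l x hx => ?_)
      · rw [Submodule.span_singleton_le_iff_mem, Submodule.mem_comap,
          hF1 _ A.vacuum_mem_weight]
        exact Submodule.mem_span_singleton_self _
      · rw [Submodule.mem_comap, hF2 l (by have := l.2; omega) x hx]
        exact zero_mem _
    intro v hv
    rw [← hF1 v hv]
    exact h trivial
  · rw [Submodule.span_singleton_le_iff_mem]
    exact A.vacuum_mem_weight
  · rw [hbot 2 (by norm_num) (by norm_num), Submodule.mem_bot] at hv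
    rw [hv, map_zero]

/-! ### The vacuum functional -/

section VacuumFunctional

variable {A : VertexOperatorSuperalgebra V} (hA : A.IsCFTType) {ε : V →ₗ[ℂ] ℂ}
  (hε : A.IsVacuumFunctional ε)
include hA hε

theorem IsVacuumFunctional.smul_vacuum {v : V} (hv : v ∈ A.weight 0) : v = ε v • A.vacuum := by
  rw [hA.weight_zero] at hv
  obtain ⟨c, rfl⟩ := Submodule.mem_span_singleton.1 hv
  simp [hε.vacuum]

/-- Only weight one could contribute, and this is where `L_one_eq_zero` is needed. The analogue for
L(-1) needs only that weight -1 is absent. -/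
theorem IsVacuumFunctional.apply_L_one (v : V) : ε (A.L 1 v) = 0 := by
  refine A.mem_of_weight_le (S := LinearMap.ker (ε ∘ₗ A.L 1)) (fun k v hv => ?_) v
  rw [LinearMap.mem_ker, LinearMap.comp_apply]
  by_cases hk : k = 2
  · subst hk; rw [hA.L_one_eq_zero v hv, map_zero]
  · exact hε.eq_zero _ (by omega) _ (A.L_mem_weight 1 one_ne_zero hv)

theorem IsVacuumFunctional.apply_L_neg_one (v : V) : ε (A.L (-1) v) = 0 := by
  refine A.mem_of_weight_le (S := LinearMap.ker (ε ∘ₗ A.L (-1))) (fun k v hv => ?_) v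
  rw [LinearMap.mem_ker, LinearMap.comp_apply]
  by_cases hk : k = -2
  · subst hk
    rw [hA.weight_neg _ (by norm_num), Submodule.mem_bot] at hv
    rw [hv, map_zero, map_zero]
  · exact hε.eq_zero _ (by omega) _ (A.L_mem_weight (-1) (by norm_num) hv)

/-- In the skew-symmetry expansion, a term with i > 0 either has positive weight or contains
v_{m+i}u of negative weight, hence zero. So ε sees only i = 0. -/
theorem IsVacuumFunctional.apply_mode_comm {a b : ℤ} {u v : V} (hu : u ∈ A.weight a)
    (hv : v ∈ A.weight b) (m : ℤ) :
    ε (A.mode u m v)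
      = -(koszulSign (a : ZMod 2) (b : ZMod 2) * (-1 : ℂ) ^ m) * ε (A.mode v m u) := by
  have hzero : ∀ i : ℕ, a + b - 2 * (m + i) - 2 < 0 → A.mode v (m + i) u = 0 := by
    intro i hi
    have h := A.mode_mem_weight hv hu (m + i)
    rw [hA.weight_neg _ (by linarith)] at h
    simpa using h
  rw [A.skew (A.weight_le_parity a hu) (A.weight_le_parity b hv) m, map_smul, smul_eq_mul]
  congr 1
  rw [← LinearMap.toAddMonoidHom_coe, AddMonoidHom.map_finsum, finsum_eq_single _ 0]
  · simp [A.creation']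
  · intro i hi
    have h1 := A.mode_mem_weight hv hu (m + i)
    have h2 := A.mode_mem_weight h1 A.vacuum_mem_weight (-1 - i)
    rw [LinearMap.toAddMonoidHom_coe, map_smul]
    by_cases h3 : a + b - 2 * (m + i) - 2 < 0
    · rw [hzero i h3]; simp [mode_zero]
    · rw [hε.eq_zero _ _ _ h2, smul_zero]
      omega
  · refine Set.Finite.subset (Set.finite_lt_nat (a + b - 2 * m).toNat) fun i hi => ?_
    rw [Function.mem_support] at hi
    by_contra h
    apply hi
    rw [hzero i (by simp at h; omega)]
    simp [mode_zero]

/-- The functional `ε` annihilates the modes `p_n`, `n ≤ 2 wt p - 2`, of a quasi-primary `p`. -/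
theorem IsVacuumFunctional.apply_mode_eq_zero {k : ℤ} {p : V} (hp : p ∈ A.weight k)
    (hp1 : A.L 1 p = 0) {n : ℤ} (hn : n ≤ k - 2) (w : V) : ε (A.mode p n w) = 0 := by
  have key : ∀ N : ℕ, ∀ b : ℤ, b < N → ∀ n ≤ k - 2, ∀ w ∈ A.weight b,
      ε (A.mode p n w) = 0 := by
    intro N
    induction N with
    | zero =>
      intro b hb n _ w hw
      rw [hA.weight_neg b (by simpa using hb), Submodule.mem_bot] at hw
      simp [hw]
    | succ N ih =>
      intro b hb n hn w hw
      -- Expanding ε(L(1) p_{n-1} w) = 0 gives ε(p_{n-1} L(1)w) + (k - 1 - n) ε(p_n w) = 0. The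
      -- first term vanishes by induction on the weight of w, and k - 1 - n ≥ 1.
      have h1 := hε.apply_L_one hA (A.mode p (n - 1) w)
      rw [A.L_one_mode hp, hp1, mode_zero, map_add, map_add,
        ih _ (by push_cast at hb; linarith) (n - 1) (by linarith) _
          (A.L_mem_weight 1 one_ne_zero hw), map_smul] at h1
      simp only [zero_add, sub_add_cancel, LinearMap.zero_apply, map_zero, add_zero,
        smul_eq_mul] at h1
      refine (mul_eq_zero.1 h1).resolve_left ?_
      have h2 : ((k - 2 - (n - 1) : ℤ) : ℂ) ≠ 0 := by
        rw [Int.cast_ne_zero]; omega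
      push_cast at h2 ⊢
      exact h2
  refine A.mem_of_weight_le (S := LinearMap.ker (ε ∘ₗ A.mode p n)) (fun b v hv => ?_) w
  exact key (b.toNat + 1) b (by push_cast; omega) n hn v hv

end VacuumFunctional

end VertexOperatorSuperalgebra

/-! ### Opposite modes and their relations with L(-1) and L(1) -/

namespace VertexOperatorSuperalgebra

variable {V : Type*} [AddCommGroup V] [Module ℂ V] (A : VertexOperatorSuperalgebra V)

/-- The opposite mode of vectors of weight `k / 2`, as a linear map on all of `V`. -/
def oppositeModeLinear (k n : ℤ) : V →ₗ[ℂ] Module.End ℂ V :=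
  (Complex.I ^ k) • ∑ j ∈ Finset.range (k.toNat + 1),
    ((j ! : ℂ)⁻¹) • (A.modeLinear (k - j - n - 2) ∘ₗ (A.L 1 ^ j))

theorem oppositeMode_eq_smul_mode {k : ℤ} {p : V} (hp1 : A.L 1 p = 0) (n : ℤ) :
    A.oppositeMode k p n = Complex.I ^ k • A.mode p (k - n - 2) := by
  rw [oppositeMode, exp_pi_mul_I_half, finsum_eq_single _ 0]
  · simp
  · intro j hj
    obtain ⟨i, rfl⟩ := Nat.exists_eq_succ_of_ne_zero hj
    rw [pow_succ, Module.End.mul_apply, hp1, map_zero, mode_zero, smul_zero]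

section

variable {A} (hA : A.IsCFTType)
include hA

/-- The cut-off `N` is left free so that sums with shifted indices can be brought to a common
length. -/
theorem oppositeMode_apply_eq_sum {k : ℤ} {v : V} (hv : v ∈ A.weight k) (n : ℤ) {N : ℕ}
    (hN : k < 2 * N) (w : V) :
    A.oppositeMode k v n w = Complex.I ^ k • ∑ j ∈ Finset.range N,
      ((j ! : ℂ)⁻¹) • A.mode ((A.L 1 ^ j) v) (k - j - n - 2) w := by
  rw [oppositeMode, exp_pi_mul_I_half, finsum_eq_sum_of_support_subset (s := Finset.range N)]
  · simp [LinearMap.sum_apply]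
  · intro j hj
    rw [Function.mem_support] at hj
    by_contra h
    apply hj
    rw [L_one_pow_eq_zero hA hv (by simp at h; omega), mode_zero, smul_zero]

theorem oppositeModeLinear_apply {k : ℤ} {v : V} (hv : v ∈ A.weight k) (n : ℤ) :
    A.oppositeModeLinear k n v = A.oppositeMode k v n := by
  ext w
  rw [oppositeMode_apply_eq_sum hA hv n (N := k.toNat + 1) (by push_cast; omega)]
  simp [oppositeModeLinear, modeLinear_apply, LinearMap.sum_apply]

/-- The opposite field also turns L(-1) into d/dz. Commuting L(-1) past L(1)^j and reindexing gives
M j the coefficient (n - k + j) + (k - j) = n; the sign is I² = -1. -/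
theorem oppositeMode_L_neg_one {k : ℤ} {v : V} (hv : v ∈ A.weight k) (n : ℤ) (w : V) :
    A.oppositeMode (k + 2) (A.L (-1) v) n w = -(n : ℂ) • A.oppositeMode k v (n - 1) w := by
  have hL := A.L_mem_weight (-1) (by norm_num) hv
  rw [show k - 2 * -1 = k + 2 by ring] at hL
  have hN : k < 2 * ((k.toNat + 1 : ℕ) : ℤ) := by push_cast; omega
  generalize k.toNat + 1 = N at hN
  rw [oppositeMode_apply_eq_sum hA hL n (N := N + 1) (by push_cast; omega),
    oppositeMode_apply_eq_sum hA hv (n - 1) hN]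
  have hI : Complex.I ^ (k + 2) = -Complex.I ^ k := by
    rw [zpow_add₀ Complex.I_ne_zero]; norm_num [Complex.I_sq]
  rw [hI, neg_smul, neg_smul, neg_inj, smul_comm]
  congr 1
  set M : ℕ → V := fun j => ((j ! : ℂ)⁻¹) • A.mode ((A.L 1 ^ j) v) (k - j - (n - 1) - 2) w with hM
  have h0 : ((0 ! : ℂ)⁻¹) • A.mode ((A.L 1 ^ 0) (A.L (-1) v)) (k + 2 - (0 : ℕ) - n - 2) w
      = ((n : ℂ) - k) • M 0 := by
    simp only [hM, pow_zero, Module.End.one_apply, mode_L_neg_one, LinearMap.smul_apply]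
    rw [show k + 2 - ((0 : ℕ) : ℤ) - n - 2 - 1 = k - ((0 : ℕ) : ℤ) - (n - 1) - 2 by ring]
    push_cast
    module
  have hS : ∀ j : ℕ, (((j + 1) ! : ℂ)⁻¹) • A.mode ((A.L 1 ^ (j + 1)) (A.L (-1) v))
      (k + 2 - (j + 1 : ℕ) - n - 2) w
        = ((n : ℂ) - k + (j + 1)) • M (j + 1) + ((k : ℂ) - j) • M j := by
    intro j
    simp only [hM, A.L_one_pow_L_neg_one hv, mode_add, mode_smul, mode_L_neg_one,
      LinearMap.smul_apply, LinearMap.add_apply]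
    rw [show k + 2 - ((j + 1 : ℕ) : ℤ) - n - 2 - 1 = k - ((j + 1 : ℕ) : ℤ) - (n - 1) - 2 by ring,
      show k + 2 - ((j + 1 : ℕ) : ℤ) - n - 2 = k - (j : ℤ) - (n - 1) - 2 by push_cast; ring,
      Nat.factorial_succ]
    have h1 : ((j ! : ℕ) : ℂ) ≠ 0 := by exact_mod_cast Nat.factorial_ne_zero j
    have h2 : (j + 1 : ℂ) ≠ 0 := by exact_mod_cast Nat.succ_ne_zero j
    push_cast
    match_scalars <;> field_simp
    ring
  rw [Finset.sum_range_succ', h0]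
  simp only [hS]
  rw [Finset.sum_add_distrib, add_right_comm,
    ← show ((n : ℂ) - k + (0 : ℕ)) • M 0 = ((n : ℂ) - k) • M 0 by simp]
  have h3 := Finset.sum_range_succ' (fun j : ℕ => ((n : ℂ) - k + j) • M j) N
  push_cast at h3 ⊢
  rw [← h3, Finset.sum_range_succ]
  have hMN : M N = 0 := by
    simp only [hM]
    rw [L_one_pow_eq_zero hA hv hN]
    simp [mode_zero]
  rw [hMN, smul_zero, add_zero, ← Finset.sum_add_distrib, Finset.smul_sum]
  refine Finset.sum_congr rfl fun j _ => ?_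
  rw [← add_smul]
  congr 1
  ring

/-- The inversion z ↦ 1/z exchanges L(1) and L(-1), so this mirrors `L_neg_one_mode`, just as
`L_neg_one_oppositeMode` mirrors `L_one_mode`. -/
theorem L_one_oppositeMode {k : ℤ} {v : V} (hv : v ∈ A.weight k) (n : ℤ) (w : V) :
    A.L 1 (A.oppositeMode k v n w)
      = A.oppositeMode k v n (A.L 1 w) + (n : ℂ) • A.oppositeMode k v (n - 1) w := by
  have hN : k < 2 * ((k.toNat + 1 : ℕ) : ℤ) := by push_cast; omega
  generalize k.toNat + 1 = N at hN
  rw [oppositeMode_apply_eq_sum hA hv n hN,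
    oppositeMode_apply_eq_sum hA hv n (N := N) hN,
    oppositeMode_apply_eq_sum hA hv (n - 1) (N := N + 1) (by push_cast; omega), map_smul,
    smul_comm (n : ℂ), ← smul_add]
  congr 1
  set M : ℕ → V := fun j => ((j ! : ℂ)⁻¹) • A.mode ((A.L 1 ^ j) v) (k - j - (n - 1) - 2) w with hM
  have hMN : M N = 0 := by
    simp only [hM]
    rw [L_one_pow_eq_zero hA hv hN]
    simp [mode_zero]
  have h : ∀ j : ℕ, A.L 1 (((j ! : ℂ)⁻¹) • A.mode ((A.L 1 ^ j) v) (k - j - n - 2) w)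
      = ((j ! : ℂ)⁻¹) • A.mode ((A.L 1 ^ j) v) (k - j - n - 2) (A.L 1 w)
        + (((n : ℂ) - j) • M j + ((j + 1 : ℕ) : ℂ) • M (j + 1)) := by
    intro j
    rw [map_smul, A.L_one_mode (A.L_one_pow_mem_weight hv j), ← Module.End.mul_apply (A.L 1),
      ← pow_succ']
    simp only [hM]
    rw [show k - (j : ℤ) - n - 2 + 1 = k - j - (n - 1) - 2 by ring,
      show k - (j : ℤ) - n - 2 = k - (j + 1 : ℕ) - (n - 1) - 2 by push_cast; ring,
      Nat.factorial_succ]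
    have h1 : ((j ! : ℕ) : ℂ) ≠ 0 := by exact_mod_cast Nat.factorial_ne_zero j
    have h2 : (j + 1 : ℂ) ≠ 0 := by exact_mod_cast Nat.succ_ne_zero j
    push_cast
    match_scalars <;> field_simp
    ring
  rw [map_sum]
  simp only [h]
  rw [Finset.sum_add_distrib, Finset.sum_add_distrib, Finset.sum_range_succ _ N, show (N ! : ℂ)⁻¹ •
      A.mode ((A.L 1 ^ N) v) (k - N - (n - 1) - 2) w = 0 from hMN, add_zero]
  congr 1
  have h3 := Finset.sum_range_succ' (fun j : ℕ => (j : ℂ) • M j) N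
  rw [Finset.sum_range_succ, hMN] at h3
  simp only [smul_zero, add_zero, Nat.cast_zero, zero_smul] at h3
  rw [← h3, ← Finset.sum_add_distrib, Finset.smul_sum]
  refine Finset.sum_congr rfl fun j _ => ?_
  rw [← add_smul]
  congr 1
  ring

theorem L_neg_one_oppositeMode {k : ℤ} {v : V} (hv : v ∈ A.weight k) (n : ℤ) (w : V) :
    A.L (-1) (A.oppositeMode k v n w)
      = A.oppositeMode k v n (A.L (-1) w) - ((k : ℂ) - n - 2) • A.oppositeMode k v (n + 1) w
        - A.oppositeMode (k - 2) (A.L 1 v) n w := by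
  have hL := A.L_mem_weight 1 one_ne_zero hv
  rw [mul_one] at hL
  have hN : k < 2 * ((k.toNat + 1 : ℕ) : ℤ) := by push_cast; omega
  generalize k.toNat + 1 = N at hN
  rw [oppositeMode_apply_eq_sum hA hv n hN,
    oppositeMode_apply_eq_sum hA hv n (N := N) hN,
    oppositeMode_apply_eq_sum hA hv (n + 1) (N := N) hN,
    oppositeMode_apply_eq_sum hA hL n (N := N) (by omega)]
  have hI : Complex.I ^ (k - 2) = -Complex.I ^ k := by
    rw [zpow_sub₀ Complex.I_ne_zero, zpow_ofNat, Complex.I_sq, div_neg, div_one]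
  rw [hI, neg_smul, map_smul, smul_comm ((k : ℂ) - n - 2), ← smul_sub, sub_neg_eq_add, ← smul_add]
  congr 1
  set M : ℕ → V := fun j => ((j ! : ℂ)⁻¹) • A.mode ((A.L 1 ^ j) v) (k - j - (n + 1) - 2) w with hM
  have hMN : M N = 0 := by
    simp only [hM]
    rw [L_one_pow_eq_zero hA hv hN]
    simp [mode_zero]
  have h : ∀ j : ℕ, A.L (-1) (((j ! : ℂ)⁻¹) • A.mode ((A.L 1 ^ j) v) (k - j - n - 2) w)
      = ((j ! : ℂ)⁻¹) • A.mode ((A.L 1 ^ j) v) (k - j - n - 2) (A.L (-1) w)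
        - ((k : ℂ) - n - 2 - j) • M j := by
    intro j
    rw [map_smul, A.L_neg_one_mode (A.L_one_pow_mem_weight hv j)]
    simp only [hM]
    rw [show k - (j : ℤ) - n - 2 - 1 = k - j - (n + 1) - 2 by ring]
    push_cast
    module
  have h' : ∀ j : ℕ, ((j ! : ℂ)⁻¹) • A.mode ((A.L 1 ^ j) (A.L 1 v)) (k - 2 - j - n - 2) w
      = ((j + 1 : ℕ) : ℂ) • M (j + 1) := by
    intro j
    simp only [hM]
    rw [← Module.End.mul_apply, ← pow_succ,
      show k - 2 - (j : ℤ) - n - 2 = k - (j + 1 : ℕ) - (n + 1) - 2 by push_cast; ring,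
      Nat.factorial_succ, smul_smul]
    congr 1
    have h1 : ((j ! : ℕ) : ℂ) ≠ 0 := by exact_mod_cast Nat.factorial_ne_zero j
    have h2 : (j + 1 : ℂ) ≠ 0 := by exact_mod_cast Nat.succ_ne_zero j
    push_cast
    field_simp
  rw [map_sum]
  simp only [h, h']
  have h3 := Finset.sum_range_succ' (fun j : ℕ => (j : ℂ) • M j) N
  rw [Finset.sum_range_succ, hMN] at h3
  simp only [smul_zero, add_zero, Nat.cast_zero, zero_smul] at h3
  rw [← h3, Finset.smul_sum, sub_add, ← Finset.sum_sub_distrib, ← Finset.sum_sub_distrib]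
  refine Finset.sum_congr rfl fun j _ => ?_
  module

variable {ε : V →ₗ[ℂ] ℂ} (hε : A.IsVacuumFunctional ε)
include hε

/-- Dual to v_n 𝟏 = 0 for n ≥ 0. On quasi-primary vectors it is `apply_mode_eq_zero`; along strings
the factor -n disposes of n = 0, where the induction hypothesis would not apply. -/
theorem IsVacuumFunctional.apply_oppositeMode_eq_zero {k : ℤ} {v : V} (hv : v ∈ A.weight k)
    {n : ℤ} (hn : 0 ≤ n) (w : V) : ε (A.oppositeMode k v n w) = 0 := by
  let S : ℤ → Submodule ℂ V := fun k =>
    { carrier := {v | ∀ n : ℤ, 0 ≤ n → ∀ w, ε (A.oppositeModeLinear k n v w) = 0}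
      add_mem' := fun hx hy n hn w => by
        rw [map_add, LinearMap.add_apply, map_add, hx n hn, hy n hn, add_zero]
      zero_mem' := fun n _ w => by simp
      smul_mem' := fun c x hx n hn w => by
        rw [map_smul, LinearMap.smul_apply, map_smul, hx n hn, smul_zero] }
  have hS : A.weight k ≤ S k := by
    refine weight_le_of_L_neg_one hA ?_ ?_ k
    · intro k p hp hp1 n hn w
      rw [oppositeModeLinear_apply hA hp, A.oppositeMode_eq_smul_mode hp1, LinearMap.smul_apply,
        map_smul, hε.apply_mode_eq_zero hA hp hp1 (by omega), smul_zero]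
    · intro k v hv hvS n hn w
      have hL := A.L_mem_weight (-1) (by norm_num) hv
      rw [show k - 2 * -1 = k + 2 by ring] at hL
      rw [oppositeModeLinear_apply hA hL, oppositeMode_L_neg_one hA hv, map_smul]
      rcases hn.eq_or_lt with rfl | hn
      · simp
      · have := hvS (n - 1) (by omega) w
        rw [oppositeModeLinear_apply hA hv] at this
        rw [this, smul_zero]
  rw [← oppositeModeLinear_apply hA hv]
  exact hS hv n hn w

end

/-- The bilinear form `⟨v, w⟩ = ε(v'_{-1} w)`, where `v'_n` are the opposite modes. -/
def IsVacuumForm (ε : V →ₗ[ℂ] ℂ) (B : LinearMap.BilinForm ℂ V) : Prop :=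
  ∀ k : ℤ, ∀ v ∈ A.weight k, ∀ w, B v w = ε (A.oppositeMode k v (-1) w)

/-! ### The vacuum form: adjointness of L(1) and L(-1), orthogonality, symmetry -/

section

variable {A} (hA : A.IsCFTType) {ε : V →ₗ[ℂ] ℂ}
include hA

theorem exists_isVacuumForm (ε : V →ₗ[ℂ] ℂ) : ∃ B, A.IsVacuumForm ε B := by
  obtain ⟨B, hB⟩ := A.exists_linearMap_of_weight fun k =>
    (A.oppositeModeLinear k (-1)).compr₂ ε
  refine ⟨B, fun k v hv w => ?_⟩
  rw [hB k v hv, LinearMap.compr₂_apply, oppositeModeLinear_apply hA hv]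

variable (hε : A.IsVacuumFunctional ε) {B : LinearMap.BilinForm ℂ V} (hB : A.IsVacuumForm ε B)
include hε hB

/-- This is ε(L(1) v'_{-1} w) = 0 expanded. The companion with L(1) on the left expands ε(L(-1)
v'_{-1} w) = 0; it is needed to prove symmetry, so it cannot be deduced from it. -/
theorem IsVacuumForm.L_neg_one_left (v w : V) : B (A.L (-1) v) w = B v (A.L 1 w) := by
  have h := A.mem_of_weight_le (S := LinearMap.ker (B ∘ₗ A.L (-1) - B.compl₂ (A.L 1)))
    (fun k v hv => ?_) v
  · rw [LinearMap.mem_ker] at h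
    have := congrArg (fun f => f w) h
    simpa [sub_eq_zero] using this
  · rw [LinearMap.mem_ker]
    ext w
    have hL := A.L_mem_weight (-1) (by norm_num) hv
    rw [show k - 2 * -1 = k + 2 by ring] at hL
    have h := hε.apply_L_one hA (A.oppositeMode k v (-1) w)
    rw [L_one_oppositeMode hA hv, map_add, map_smul] at h
    simp only [LinearMap.sub_apply, LinearMap.comp_apply, LinearMap.compl₂_apply,
      LinearMap.zero_apply]
    rw [hB _ _ hL, hB _ _ hv, oppositeMode_L_neg_one hA hv, map_smul]
    simp at h ⊢
    linear_combination -h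

theorem IsVacuumForm.L_one_left (v w : V) : B (A.L 1 v) w = B v (A.L (-1) w) := by
  have h := A.mem_of_weight_le (S := LinearMap.ker (B ∘ₗ A.L 1 - B.compl₂ (A.L (-1))))
    (fun k v hv => ?_) v
  · rw [LinearMap.mem_ker] at h
    have := congrArg (fun f => f w) h
    simpa [sub_eq_zero] using this
  · rw [LinearMap.mem_ker]
    ext w
    have hL := A.L_mem_weight 1 one_ne_zero hv
    rw [mul_one] at hL
    have h := hε.apply_L_neg_one hA (A.oppositeMode k v (-1) w)
    rw [L_neg_one_oppositeMode hA hv, map_sub, map_sub, map_smul, neg_add_cancel,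
      hε.apply_oppositeMode_eq_zero hA hv le_rfl] at h
    simp only [LinearMap.sub_apply, LinearMap.comp_apply, LinearMap.compl₂_apply,
      LinearMap.zero_apply]
    rw [hB _ _ hL, hB _ _ hv]
    simp at h ⊢
    linear_combination -h

theorem IsVacuumForm.eq_zero_of_ne {a b : ℤ} (hab : a ≠ b) {v w : V} (hv : v ∈ A.weight a)
    (hw : w ∈ A.weight b) : B v w = 0 := by
  rw [hB a v hv, oppositeMode_apply_eq_sum hA hv (-1) (N := a.toNat + 1) (by push_cast; omega),
    map_smul, map_sum, Finset.sum_eq_zero, smul_zero]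
  intro j _
  rw [map_smul, hε.eq_zero _ _ _ (A.mode_mem_weight (A.L_one_pow_mem_weight hv j) hw _), smul_zero]
  omega

omit hA hε in
theorem IsVacuumForm.apply_of_L_one_eq_zero {k : ℤ} {p : V} (hp : p ∈ A.weight k)
    (hp1 : A.L 1 p = 0) (w : V) : B p w = Complex.I ^ k * ε (A.mode p (k - 1) w) := by
  rw [hB k p hp, A.oppositeMode_eq_smul_mode hp1, LinearMap.smul_apply, map_smul, smul_eq_mul,
    show k - -1 - 2 = k - 1 by ring]

theorem IsVacuumForm.isSymm : B.IsSymm := by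
  constructor
  intro v w
  have key : ∀ k, A.weight k ≤ LinearMap.ker (B - LinearMap.flip B) := by
    intro k
    refine weight_le_of_L_neg_one hA (S := fun _ => LinearMap.ker (B - LinearMap.flip B)) ?_ ?_ k
    · intro k p hp hp1
      rw [LinearMap.mem_ker]
      ext w
      refine sub_eq_zero.2 ?_
      rw [LinearMap.flip_apply]
      have h := A.mem_of_weight_le (S := LinearMap.ker (B p - LinearMap.flip B p)) (fun l w hw => ?_) w
      · simpa [sub_eq_zero] using h
      · rw [LinearMap.mem_ker, LinearMap.sub_apply, LinearMap.flip_apply, sub_eq_zero]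
        by_cases hkl : k = l
        · subst hkl
          have h1 : B w p = Complex.I ^ k * ε (A.mode w (k - 1) p) := by
            rw [hB k w hw, oppositeMode_apply_eq_sum hA hw (-1) (N := k.toNat + 1)
              (by push_cast; omega), map_smul, map_sum, Finset.sum_eq_single 0]
            · simp [show k + 1 - 2 = k - 1 by ring]
            -- After the commutation, p carries the index k - j - 1 ≤ k - 2, which ε annihilates.
            · intro j _ hj
              rw [map_smul, hε.apply_mode_comm hA (A.L_one_pow_mem_weight hw j) hp,
                hε.apply_mode_eq_zero hA hp hp1 (by omega), mul_zero, smul_zero]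
            · simp
          -- The Koszul sign (-1)^k and the factor -(-1)^{k-1} cancel.
          rw [hB.apply_of_L_one_eq_zero hp hp1, h1, hε.apply_mode_comm hA hp hw,
            koszulSign_intCast_self, ← zpow_add₀ (by norm_num),
            show k + (k - 1) = 2 * (k - 1) + 1 by ring]
          rw [(odd_two_mul_add_one (k - 1)).neg_one_zpow]
          ring
        · rw [hB.eq_zero_of_ne hA hε hkl hp hw, hB.eq_zero_of_ne hA hε (Ne.symm hkl) hw hp]
    · intro k v _ hv
      rw [LinearMap.mem_ker] at hv ⊢
      ext w
      have h1 := congrArg (fun f => f (A.L 1 w)) hv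
      simp only [LinearMap.sub_apply, LinearMap.flip_apply, LinearMap.zero_apply,
        sub_eq_zero] at h1 ⊢
      rw [hB.L_neg_one_left hA hε, h1, hB.L_one_left hA hε]
  have h := A.mem_of_weight_le key v
  rw [LinearMap.mem_ker] at h
  have := congrArg (fun f => f w) h
  simpa [sub_eq_zero] using this

end

end VertexOperatorSuperalgebra

/-! ### Three-point functions and invariance -/

/-- Vandermonde for n + (-(n + 1)) = -1. The sum arises when the iterate formula is evaluated on
three quasi-primary vectors. -/
theorem sum_neg_one_pow_mul_choose_mul_choose (n : ℤ) (Q : ℕ) :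
    ∑ i ∈ Finset.range (Q + 1), (-1) ^ i * Ring.choose n i *
      Ring.choose (n + (Q - i : ℕ)) (Q - i) = 1 := by
  have hneg : ∀ j : ℕ, Ring.choose (n + j) j = (-1) ^ j * Ring.choose (-(n + 1)) j := by
    intro j
    rw [Ring.choose_neg, Units.smul_def, smul_eq_mul, Int.coe_negOnePow_natCast, ← mul_assoc,
      ← mul_pow, show n + 1 + (j : ℤ) - 1 = n + j by ring]
    simp
  have h := Ring.add_choose_eq Q (Commute.all n (-(n + 1)))
  rw [Finset.Nat.sum_antidiagonal_eq_sum_range_succ_mk, show n + -(n + 1) = -1 by ring,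
    Ring.choose_neg, show (1 : ℤ) + Q - 1 = Q by ring, Ring.choose_natCast, Nat.choose_self,
    Units.smul_def, Int.coe_negOnePow_natCast] at h
  have h1 : ∀ i ∈ Finset.range (Q + 1), (-1) ^ i * Ring.choose n i *
      Ring.choose (n + (Q - i : ℕ)) (Q - i)
        = (-1) ^ Q * (Ring.choose n i * Ring.choose (-(n + 1)) (Q - i)) := by
    intro i hi
    rw [hneg]
    have : (-1 : ℤ) ^ Q = (-1) ^ i * (-1) ^ (Q - i) := by
      rw [← pow_add, Nat.add_sub_cancel' (Nat.lt_succ_iff.1 (Finset.mem_range.1 hi))]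
    rw [this]
    ring
  rw [Finset.sum_congr rfl h1, ← Finset.mul_sum, ← h, smul_eq_mul, ← mul_assoc, ← mul_pow]
  simp

namespace VertexOperatorSuperalgebra

variable {V : Type*} [AddCommGroup V] [Module ℂ V] {A : VertexOperatorSuperalgebra V}
  (hA : A.IsCFTType) {ε : V →ₗ[ℂ] ℂ} (hε : A.IsVacuumFunctional ε)
include hA hε

/-- The dependence of a three-point function of quasi-primary vectors on the modes. -/
theorem IsVacuumFunctional.three_point {k l : ℤ} {u v w : V} (hu : u ∈ A.weight k)
    (hu1 : A.L 1 u = 0) (hv : v ∈ A.weight l) (hv1 : A.L 1 v = 0) (hw1 : A.L 1 w = 0)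
    {n Q : ℤ} (hQ : n + Q = k - 2) (i : ℕ) :
    ε (A.mode v (l - 1 + i) (A.mode u (Q - i) w))
      = (Ring.choose (n + i) i : ℤ) * ε (A.mode v (l - 1) (A.mode u Q w)) := by
  induction i with
  | zero => simp
  | succ i ih =>
    -- With F(i) the left-hand side, this is the recursion (i + 1) F(i + 1) = (n + i + 1) F(i).
    have h1 := hε.apply_L_one hA (A.mode v (l - 1 + i) (A.mode u (Q - i - 1) w))
    rw [A.L_one_mode hv, A.L_one_mode hu, hu1, hv1, hw1] at h1
    simp only [mode_zero, map_zero, LinearMap.zero_apply, add_zero, zero_add, map_add, map_smul,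
      sub_add_cancel, ih, smul_eq_mul] at h1
    have h2 := Ring.choose_add_smul_choose (n + i) i 1
    rw [Nat.choose_one_right, Ring.choose_one_right, nsmul_eq_mul] at h2
    have h3 : ((i + 1 : ℕ) : ℂ) * ((Ring.choose (n + i + (1 : ℕ)) (i + 1) : ℤ) : ℂ)
        = ((n + i + 1 : ℤ) : ℂ) * ((Ring.choose (n + i) i : ℤ) : ℂ) := by
      exact_mod_cast h2
    have h4 : (n : ℂ) + Q = k - 2 := by exact_mod_cast hQ
    rw [show l - 1 + ((i + 1 : ℕ) : ℤ) = l - 1 + i + 1 by push_cast; ring,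
      show Q - ((i + 1 : ℕ) : ℤ) = Q - i - 1 by push_cast; ring,
      show n + ((i + 1 : ℕ) : ℤ) = n + i + (1 : ℕ) by push_cast; ring]
    have h5 : ((i : ℂ) + 1) ≠ 0 := by exact_mod_cast Nat.succ_ne_zero i
    apply mul_left_cancel₀ h5
    push_cast at h1 h3 ⊢
    linear_combination -h1 - ε (A.mode v (l - 1) (A.mode u Q w)) * h3 -
      ((Ring.choose (n + i) i : ℤ) : ℂ) * ε (A.mode v (l - 1) (A.mode u Q w)) * h4

/-- In the iterate formula ε kills every product with u outermost, since n - i ≤ k - 2, and every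
product with v outermost for i > Q. The rest are multiples of one number by `three_point`, with
coefficients summing to 1. -/
theorem IsVacuumFunctional.apply_mode_mode {k l m : ℤ} {u v w : V} (hu : u ∈ A.weight k)
    (hu1 : A.L 1 u = 0) (hv : v ∈ A.weight l) (hv1 : A.L 1 v = 0) (hw : w ∈ A.weight m)
    (hw1 : A.L 1 w = 0) {n : ℤ} {Q : ℕ} (hQ : n + Q = k - 2) :
    ε (A.mode (A.mode u n v) (l - 1 + Q - n) w)
      = -(koszulSign (k : ZMod 2) (l : ZMod 2) * (-1) ^ n) *
        ε (A.mode v (l - 1) (A.mode u Q w)) := by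
  rw [A.iterate (A.weight_le_parity k hu) (A.weight_le_parity l hv), ← LinearMap.toAddMonoidHom_coe,
    AddMonoidHom.map_finsum]
  · rw [finsum_eq_sum_of_support_subset (s := Finset.range (Q + 1))]
    · have h1 : ∀ i ∈ Finset.range (Q + 1),
          ε.toAddMonoidHom (((-1 : ℂ) ^ i * ((Ring.choose n i : ℤ) : ℂ)) •
            (A.mode u (n - i) (A.mode v (l - 1 + Q - n + i) w)
              - (koszulSign (k : ZMod 2) (l : ZMod 2) * (-1 : ℂ) ^ n) •
                A.mode v (n + (l - 1 + Q - n) - i) (A.mode u i w)))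
            = -(koszulSign (k : ZMod 2) (l : ZMod 2) * (-1) ^ n) *
              ε (A.mode v (l - 1) (A.mode u Q w)) *
              (((-1) ^ i * Ring.choose n i * Ring.choose (n + (Q - i : ℕ)) (Q - i) : ℤ) : ℂ) := by
        intro i hi
        have hi : i ≤ Q := Nat.lt_succ_iff.1 (Finset.mem_range.1 hi)
        have h2 := hε.three_point hA hu hu1 hv hv1 hw1 hQ (Q - i)
        rw [show (Q : ℤ) - (Q - i : ℕ) = i by omega] at h2
        rw [LinearMap.toAddMonoidHom_coe, map_smul, map_sub, map_smul,
          hε.apply_mode_eq_zero hA hu hu1 (by omega),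
          show n + (l - 1 + Q - n) - (i : ℤ) = l - 1 + (Q - i : ℕ) by omega, h2]
        simp only [smul_eq_mul]
        push_cast
        ring
      rw [Finset.sum_congr rfl h1, ← Finset.mul_sum, ← Int.cast_sum,
        sum_neg_one_pow_mul_choose_mul_choose, Int.cast_one, mul_one]
      rfl
    · intro i hi
      rw [Function.mem_support] at hi
      by_contra h
      apply hi
      have h : Q < i := by simpa using h
      rw [LinearMap.toAddMonoidHom_coe, map_smul, map_sub, map_smul,
        hε.apply_mode_eq_zero hA hu hu1 (by omega), hε.apply_mode_eq_zero hA hv hv1 (by omega)]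
      simp
  -- Moving ε inside the `finsum` requires finite support, which holds because weights are bounded
  -- below.
  · have hzero : ∀ {a b : ℤ} {x y : V}, x ∈ A.weight a → y ∈ A.weight b → ∀ i : ℤ,
        a + b - 2 * i - 2 < 0 → A.mode x i y = 0 := by
      intro a b x y hx hy i hi
      have h := A.mode_mem_weight hx hy i
      rw [hA.weight_neg _ hi] at h
      simpa using h
    refine Set.Finite.subset
      (Set.finite_lt_nat ((l + m - 2 * (l - 1 + Q - n)).toNat + (k + m).toNat)) fun i hi => ?_
    rw [Function.mem_support] at hi
    by_contra h
    apply hi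
    have h : (l + m - 2 * (l - 1 + Q - n)).toNat + (k + m).toNat ≤ i := by simpa using h
    rw [hzero hv hw _ (by omega), hzero hu hw _ (by omega)]
    simp

variable {B : LinearMap.BilinForm ℂ V} (hB : A.IsVacuumForm ε B)
include hB

/-- Symmetry puts the quasi-primary w first, and `apply_mode_comm` then yields ε((u_n v)_{m-1} w),
the quantity of `apply_mode_mode`. -/
theorem IsVacuumForm.apply_mode_of_nonneg {k l m : ℤ} {u v w : V} (hu : u ∈ A.weight k)
    (hu1 : A.L 1 u = 0) (hv : v ∈ A.weight l) (hv1 : A.L 1 v = 0) (hw : w ∈ A.weight m)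
    (hw1 : A.L 1 w = 0) {n : ℤ} {Q : ℕ} (hQ : n + Q = k - 2) (hm : k + l - 2 * n - 2 = m) :
    B (A.mode u n v) w = koszulSign (k : ZMod 2) (l : ZMod 2) * Complex.I ^ k *
      B v (A.mode u Q w) := by
  have huv := A.mode_mem_weight hu hv n
  rw [hm] at huv
  rw [(hB.isSymm hA hε).eq, hB.apply_of_L_one_eq_zero hw hw1, hB.apply_of_L_one_eq_zero hv hv1,
    hε.apply_mode_comm hA hw huv, koszulSign_intCast_self, ← zpow_add₀ (by norm_num),
    show m + (m - 1) = 2 * (m - 1) + 1 by ring, (odd_two_mul_add_one (m - 1)).neg_one_zpow,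
    show m - 1 = l - 1 + Q - n by omega, hε.apply_mode_mode hA hu hu1 hv hv1 hw hw1 hQ]
  have h1 : Complex.I ^ m * (-1) ^ n = -(Complex.I ^ k * Complex.I ^ l) := by
    rw [← Complex.I_sq, ← zpow_natCast, ← zpow_mul, ← zpow_add₀ Complex.I_ne_zero,
      ← zpow_add₀ Complex.I_ne_zero, show k + l = m + (2 : ℕ) * n + 2 by push_cast; omega,
      zpow_add₀ Complex.I_ne_zero _ 2]
    norm_num
  linear_combination (-koszulSign (k : ZMod 2) (l : ZMod 2) *
    ε (A.mode v (l - 1) (A.mode u Q w))) * h1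

/-- Invariance of the vacuum form for three quasi-primary vectors. -/
theorem IsVacuumForm.apply_mode_of_quasiPrimary {k l m : ℤ} {u v w : V} (hu : u ∈ A.weight k)
    (hu1 : A.L 1 u = 0) (hv : v ∈ A.weight l) (hv1 : A.L 1 v = 0) (hw : w ∈ A.weight m)
    (hw1 : A.L 1 w = 0) (n : ℤ) :
    B (A.mode u n v) w = koszulSign (k : ZMod 2) (l : ZMod 2) * Complex.I ^ k *
      B v (A.mode u (k - 2 - n) w) := by
  by_cases hm : k + l - 2 * n - 2 = m
  -- If k - 2 - n < 0 ≤ n, symmetry exchanges v and w, and with them n and k - 2 - n. If both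
  -- indices are negative then k ≤ 0, so u is zero or a multiple of the vacuum.
  · rcases le_or_gt 0 (k - 2 - n) with h | h
    · obtain ⟨Q, hQ⟩ := Int.eq_ofNat_of_zero_le h
      rw [hQ]
      exact hB.apply_mode_of_nonneg hA hε hu hu1 hv hv1 hw hw1 (by omega) hm
    rcases le_or_gt 0 n with hn | hn
    · obtain ⟨N, rfl⟩ := Int.eq_ofNat_of_zero_le hn
      have h1 := hB.apply_mode_of_nonneg hA hε hu hu1 hw hw1 hv hv1
        (n := k - 2 - N) (Q := N) (by omega) (by omega)
      rw [(hB.isSymm hA hε).eq v, h1, (hB.isSymm hA hε).eq w]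
      have h2 : koszulSign (k : ZMod 2) (l : ZMod 2) * koszulSign (k : ZMod 2) (m : ZMod 2)
          = (-1) ^ k := by
        rw [← koszulSign_add_right, ← koszulSign_intCast_self]
        congr 1
        rw [← Int.cast_add, ZMod.intCast_eq_intCast_iff_dvd_sub]
        exact ⟨N + 1 - l, by push_cast; omega⟩
      have h3 : Complex.I ^ k * Complex.I ^ k = (-1) ^ k := by
        rw [← mul_zpow, Complex.I_mul_I]
      have h4 : (-1 : ℂ) ^ k * (-1) ^ k = 1 := by
        rw [← mul_zpow]; simp
      linear_combination (-(Complex.I ^ k * Complex.I ^ k) * h2 - (-1) ^ k * h3 - h4) *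
        B (A.mode u N v) w
    · rcases (show k ≤ 0 by omega).eq_or_lt with rfl | hk
      · obtain rfl : n = -1 := by omega
        rw [hε.smul_vacuum hA hu]
        simp [mode_smul, vacuum_mode', koszulSign_zero_left]
      · rw [hA.weight_neg k hk, Submodule.mem_bot] at hu
        simp [hu, mode_zero]
  · rw [hB.eq_zero_of_ne hA hε hm (A.mode_mem_weight hu hv n) hw,
      hB.eq_zero_of_ne hA hε _ hv (A.mode_mem_weight hu hw _), mul_zero]
    omega

/-- Adjointness of L(1) and L(-1), with their commutators with u_n, propagates the identity along
strings: first in w for quasi-primary v, then in v. -/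
theorem IsVacuumForm.apply_mode_of_quasiPrimary_left {k l : ℤ} {u v : V} (hu : u ∈ A.weight k)
    (hu1 : A.L 1 u = 0) (hv : v ∈ A.weight l) (n : ℤ) (w : V) :
    B (A.mode u n v) w = koszulSign (k : ZMod 2) (l : ZMod 2) * Complex.I ^ k *
      B v (A.mode u (k - 2 - n) w) := by
  have hsymm := hB.isSymm hA hε
  let S : ℤ → Submodule ℂ V := fun l =>
    { carrier := {v | ∀ (n : ℤ) (w : V), B (A.mode u n v) w =
        koszulSign (k : ZMod 2) (l : ZMod 2) * Complex.I ^ k * B v (A.mode u (k - 2 - n) w)}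
      add_mem' := fun hx hy n w => by
        simp only [map_add, LinearMap.add_apply, hx n w, hy n w, mul_add]
      zero_mem' := fun n w => by simp
      smul_mem' := fun c x hx n w => by
        simp only [map_smul, LinearMap.smul_apply, hx n w, smul_eq_mul]
        ring }
  refine weight_le_of_L_neg_one hA (S := S) ?_ ?_ l hv n w
  · intro l v hv hv1 n w
    let T : ℤ → Submodule ℂ V := fun _ =>
      { carrier := {w | ∀ n : ℤ, B (A.mode u n v) w =
          koszulSign (k : ZMod 2) (l : ZMod 2) * Complex.I ^ k * B v (A.mode u (k - 2 - n) w)}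
        add_mem' := fun hx hy n => by
          simp only [map_add, hx n, hy n, mul_add]
        zero_mem' := fun n => by simp
        smul_mem' := fun c x hx n => by
          simp only [map_smul, hx n, smul_eq_mul]
          ring }
    have hT : ∀ m, A.weight m ≤ T 0 := by
      refine weight_le_of_L_neg_one hA (S := T) ?_ ?_
      · intro m w hw hw1 n
        exact hB.apply_mode_of_quasiPrimary hA hε hu hu1 hv hv1 hw hw1 n
      · intro m w _ hwT n
        have h1 := hwT (n + 1)
        have h2 := A.L_neg_one_mode hu (k - 2 - n) w
        rw [eq_sub_iff_add_eq] at h2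
        rw [← hB.L_one_left hA hε, A.L_one_mode hu, hu1, hv1, ← h2, map_add (B v), map_smul (B v),
          ← hB.L_one_left hA hε, hv1, show k - 2 - n - 1 = k - 2 - (n + 1) by ring]
        simp only [map_zero, mode_zero, LinearMap.zero_apply, zero_add, add_zero, map_smul,
          LinearMap.smul_apply, smul_eq_mul, h1]
        push_cast
        ring
    exact A.mem_of_weight_le hT w n
  · intro l v _ hvS n w
    have h1 := hvS n (A.L 1 w)
    have h2 := hvS (n - 1) w
    have h3 := A.L_neg_one_mode hu n v
    rw [eq_sub_iff_add_eq] at h3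
    have h4 := A.L_one_mode hu (k - 2 - n) w
    rw [hu1, mode_zero, LinearMap.zero_apply, add_zero] at h4
    have h5 : ((l + 2 : ℤ) : ZMod 2) = (l : ZMod 2) := by
      rw [ZMod.intCast_eq_intCast_iff_dvd_sub]
      exact ⟨-1, by push_cast; ring⟩
    rw [← h3, hB.L_neg_one_left hA hε, h5, h4, map_add B, LinearMap.add_apply,
      hB.L_neg_one_left hA hε, map_smul, LinearMap.smul_apply, h1, h2, map_add, map_smul,
      show k - 2 - (n - 1) = k - 2 - n + 1 by ring]
    simp only [smul_eq_mul]
    push_cast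
    ring

theorem IsVacuumForm.isInvariant : A.IsInvariant B := by
  have key : ∀ (k l : ℤ) (u v w : V) (n : ℤ), u ∈ A.weight k → v ∈ A.weight l →
      B (A.mode u n v) w = koszulSign (k : ZMod 2) (l : ZMod 2) *
        B v (A.oppositeMode k u n w) := by
    intro k l u v w n hu hv
    let S : ℤ → Submodule ℂ V := fun k =>
      { carrier := {u | ∀ (n : ℤ) (w : V), B (A.mode u n v) w =
          koszulSign (k : ZMod 2) (l : ZMod 2) * B v (A.oppositeModeLinear k n u w)}
        add_mem' := fun hx hy n w => by
          simp only [map_add, mode_add, LinearMap.add_apply, hx n w, hy n w, mul_add]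
        zero_mem' := fun n w => by simp [mode_zero]
        smul_mem' := fun c x hx n w => by
          simp only [map_smul, mode_smul, LinearMap.smul_apply, hx n w, smul_eq_mul]
          ring }
    rw [← oppositeModeLinear_apply hA hu]
    refine weight_le_of_L_neg_one hA (S := S) ?_ ?_ k hu n w
    · intro k p hp hp1 n w
      rw [oppositeModeLinear_apply hA hp, A.oppositeMode_eq_smul_mode hp1,
        hB.apply_mode_of_quasiPrimary_left hA hε hp hp1 hv, LinearMap.smul_apply, map_smul,
        smul_eq_mul, mul_assoc, show k - n - 2 = k - 2 - n by ring]
    -- Replacing u by L(-1)u multiplies both sides by -n and lowers n by one; the parity is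
    -- unchanged.
    · intro k u hu huS n w
      have hL := A.L_mem_weight (-1) (by norm_num) hu
      rw [show k - 2 * -1 = k + 2 by ring] at hL
      have h1 := huS (n - 1) w
      have h5 : ((k + 2 : ℤ) : ZMod 2) = (k : ZMod 2) := by
        rw [ZMod.intCast_eq_intCast_iff_dvd_sub]
        exact ⟨-1, by push_cast; ring⟩
      rw [oppositeModeLinear_apply hA hu] at h1
      rw [oppositeModeLinear_apply hA hL, oppositeMode_L_neg_one hA hu, mode_L_neg_one, h5,
        LinearMap.smul_apply, map_smul, LinearMap.smul_apply, h1, map_smul]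
      simp only [smul_eq_mul]
      ring
  intro k β u v w n hu hv
  let S : Submodule ℂ V :=
    { carrier := {v | B (A.mode u n v) w =
        koszulSign (k : ZMod 2) β * B v (A.oppositeMode k u n w)}
      add_mem' := fun hx hy => by
        rw [Set.mem_ofPred_eq] at hx hy ⊢
        simp only [map_add, LinearMap.add_apply, hx, hy, mul_add]
      zero_mem' := by simp
      smul_mem' := fun c x hx => by
        rw [Set.mem_ofPred_eq] at hx ⊢
        simp only [map_smul, LinearMap.smul_apply, hx, smul_eq_mul]
        ring }
  have hS : A.parity β ≤ S := by
    refine iSup_le fun l v hv => ?_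
    have := key k l u v w n hu hv
    rwa [l.2] at this
  exact hS hv

end VertexOperatorSuperalgebra

/-! ### Ideals, the kernel, uniqueness -/

namespace VertexOperatorSuperalgebra

variable {V : Type*} [AddCommGroup V] [Module ℂ V] {A : VertexOperatorSuperalgebra V}

/-- A subspace invariant under `L(0)` is graded. -/
theorem le_iSup_inf_weight {J : Submodule ℂ V} (hJ : ∀ v ∈ J, A.L 0 v ∈ J) :
    J ≤ ⨆ k, J ⊓ A.weight k := by
  classical
  have key : ∀ (k : ℤ) (s : Finset ℤ), k ∉ s → ∀ v ∈ J, ∀ x ∈ A.weight k, ∀ y ∈ ⨆ l ∈ s, A.weight l,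
      v = x + y → x ∈ J := by
    intro k s
    induction s using Finset.induction_on with
    | empty =>
      rintro _ v hv x _ y hy rfl
      have hy : y = 0 := by simpa using hy
      simpa [hy] using hv
    | insert l s hl ih =>
      rintro hk v hv x hx y hy rfl
      rw [Finset.mem_insert, not_or] at hk
      rw [Finset.iSup_insert] at hy
      obtain ⟨a, ha, b, hb, rfl⟩ := Submodule.mem_sup.1 hy
      have hc : ((k : ℂ) / 2 - l / 2) ≠ 0 := by
        rw [← sub_div]
        exact div_ne_zero (sub_ne_zero.2 (by exact_mod_cast hk.1)) two_ne_zero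
      have hb' : A.L 0 b - ((l : ℂ) / 2) • b ∈ ⨆ l ∈ s, A.weight l := by
        have h : (⨆ l ∈ s, A.weight l) ≤ (⨆ l ∈ s, A.weight l).comap (A.L 0) := by
          refine iSup₂_le fun j hj z hz => ?_
          rw [Submodule.mem_comap, A.mem_weight.1 hz]
          exact Submodule.smul_mem _ _ (Submodule.mem_iSup_of_mem j (Submodule.mem_iSup_of_mem hj hz))
        exact sub_mem (h hb) (Submodule.smul_mem _ _ hb)
      -- L(0) - l/2 removes the component of index l and scales x by a nonzero number.
      have h1 := ih hk.2 _ (sub_mem (hJ _ hv) (Submodule.smul_mem J ((l : ℂ) / 2) hv))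
        (((k : ℂ) / 2 - l / 2) • x) (Submodule.smul_mem _ _ hx) _ hb' (by
          rw [map_add, map_add, A.mem_weight.1 hx, A.mem_weight.1 ha]
          module)
      simpa [smul_smul, inv_mul_cancel₀ hc] using
        Submodule.smul_mem J (((k : ℂ) / 2 - l / 2)⁻¹) h1
  have hfin : ∀ s : Finset ℤ, ∀ v ∈ J, v ∈ ⨆ l ∈ s, A.weight l → v ∈ ⨆ k, J ⊓ A.weight k := by
    intro s
    induction s using Finset.induction_on with
    | empty =>
      intro v _ hv
      have hv : v = 0 := by simpa using hv
      rw [hv]; exact zero_mem _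
    | insert l s hl ih =>
      intro v hv hvs
      rw [Finset.iSup_insert] at hvs
      obtain ⟨x, hx, y, hy, rfl⟩ := Submodule.mem_sup.1 hvs
      have hxJ := key l s hl _ hv x hx y hy rfl
      exact add_mem (Submodule.mem_iSup_of_mem l ⟨hxJ, hx⟩)
        (ih y (by simpa using sub_mem hv hxJ) hy)
  intro v hv
  have h : v ∈ ⨆ l, A.weight l := by rw [A.iSup_weight]; trivial
  obtain ⟨s, hs⟩ := (Submodule.mem_iSup_iff_exists_finset).1 h
  exact hfin s v hv hs

theorem IsIdeal.eq_top_of_vacuum_mem {J : Submodule ℂ V} (hJ : A.IsIdeal J)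
    (h : A.vacuum ∈ J) : J = ⊤ := by
  refine Submodule.eq_top_iff'.2 fun v => ?_
  rw [← A.creation' v]
  exact hJ.mode_right _ _ _ h

/-- A subspace stable under all modes is an ideal. -/
theorem IsIdeal.of_mode_right {J : Submodule ℂ V}
    (hJ : ∀ (u w : V) (n : ℤ), w ∈ J → A.mode u n w ∈ J) : A.IsIdeal J := by
  refine ⟨hJ, fun u w n hw => ?_⟩
  -- Up to a nonzero scalar, x_{-1-i}𝟏 is obtained from x by applying L(-1) i times. Skew-symmetry
  -- writes w_n u through such vectors.
  have hcr : ∀ (i : ℕ) (x : V), x ∈ J → A.mode x (-1 - i) A.vacuum ∈ J := by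
    intro i
    induction i with
    | zero => intro x hx; simpa [A.creation'] using hx
    | succ i ih =>
      intro x hx
      have h1 := ih _ (hJ A.omega x (-1 + 1) hx)
      rw [← L_eq_mode, mode_L_neg_one, LinearMap.smul_apply,
        show -1 - (i : ℤ) - 1 = -1 - ((i + 1 : ℕ) : ℤ) by push_cast; ring] at h1
      have h2 : (-((-1 - i : ℤ) : ℂ)) ≠ 0 := by
        rw [neg_ne_zero, Int.cast_ne_zero]; omega
      have h3 := J.smul_mem (-((-1 - i : ℤ) : ℂ))⁻¹ h1
      rwa [smul_smul, inv_mul_cancel₀ h2, one_smul] at h3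
  have hom : ∀ k l : ℤ, ∀ u ∈ A.weight k, ∀ w ∈ A.weight l, w ∈ J → A.mode w n u ∈ J := by
    intro k l u hu w hw hwJ
    rw [A.skew (A.weight_le_parity l hw) (A.weight_le_parity k hu)]
    exact J.smul_mem _ (finsum_induction (· ∈ J) J.zero_mem (fun _ _ => J.add_mem)
      fun i => J.smul_mem _ (hcr i _ (hJ _ _ _ hwJ)))
  let S : Submodule ℂ V :=
    { carrier := {w | ∀ u, A.mode w n u ∈ J}
      add_mem' := fun hx hy u => by
        rw [mode_add, LinearMap.add_apply]; exact J.add_mem (hx u) (hy u)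
      zero_mem' := fun u => by simp [mode_zero]
      smul_mem' := fun c x hx u => by
        rw [mode_smul, LinearMap.smul_apply]; exact J.smul_mem c (hx u) }
  have hS : (⨆ k, J ⊓ A.weight k) ≤ S := iSup_le fun l w hw u =>
    A.mem_of_weight_le (S := J.comap (A.mode w n)) (fun k u hu => hom k l u hu w hw.2 hw.1) u
  exact hS (le_iSup_inf_weight (fun v hv => hJ A.omega v (0 + 1) hv) hw) u

section

variable (hA : A.IsCFTType) {ε : V →ₗ[ℂ] ℂ} (hε : A.IsVacuumFunctional ε)
include hA hε

theorem IsIdeal.apply_eq_zero {J : Submodule ℂ V} (hJ : A.IsIdeal J) (hJT : J ≠ ⊤) {v : V}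
    (hv : v ∈ J) : ε v = 0 := by
  have h : (⨆ k, J ⊓ A.weight k) ≤ LinearMap.ker ε := by
    refine iSup_le fun k x hx => ?_
    rw [LinearMap.mem_ker]
    by_cases hk : k = 0
    · subst hk
      by_contra h0
      refine hJT (hJ.eq_top_of_vacuum_mem ?_)
      have h1 := J.smul_mem (ε x)⁻¹ hx.1
      rwa [hε.smul_vacuum hA hx.2, map_smul, hε.vacuum, smul_eq_mul, mul_one, smul_smul,
        inv_mul_cancel₀ h0, one_smul] at h1
    · exact hε.eq_zero k hk x hx.2
  exact h (le_iSup_inf_weight (fun v hv => hJ.mode_right A.omega v (0 + 1) hv) hv)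

variable {B : LinearMap.BilinForm ℂ V} (hB : A.IsVacuumForm ε B)
include hB

omit hA hε in
theorem IsVacuumForm.apply_vacuum (w : V) : B A.vacuum w = ε w := by
  rw [hB.apply_of_L_one_eq_zero A.vacuum_mem_weight A.L_one_vacuum]
  simp [vacuum_mode']

/-- The kernel of the vacuum form is an ideal. -/
theorem IsVacuumForm.isIdeal_ker : A.IsIdeal (LinearMap.ker B) := by
  have hsymm := hB.isSymm hA hε
  have hmem : ∀ w, w ∈ LinearMap.ker B ↔ ∀ x, B x w = 0 := fun w => by
    rw [LinearMap.mem_ker]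
    exact ⟨fun h x => by rw [hsymm.eq, h, LinearMap.zero_apply],
      fun h => LinearMap.ext fun x => by rw [hsymm.eq, h, LinearMap.zero_apply]⟩
  refine IsIdeal.of_mode_right fun u w n hw => ?_
  rw [hmem] at hw
  let S : Submodule ℂ V :=
    { carrier := {u | ∀ n, A.mode u n w ∈ LinearMap.ker B}
      add_mem' := fun hx hy n => by
        rw [mode_add, LinearMap.add_apply]; exact add_mem (hx n) (hy n)
      zero_mem' := fun n => by simp [mode_zero]
      smul_mem' := fun c x hx n => by
        rw [mode_smul, LinearMap.smul_apply]; exact Submodule.smul_mem _ c (hx n) }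
  have hS : ∀ k, A.weight k ≤ S := by
    refine weight_le_of_L_neg_one hA (S := fun _ => S) ?_ ?_
    · intro k p hp hp1 n
      rw [hmem]
      intro x
      refine A.mem_of_weight_le (S := LinearMap.ker (LinearMap.flip B (A.mode p n w)))
        (fun l x hx => ?_) x
      rw [LinearMap.mem_ker, LinearMap.flip_apply]
      -- The index k - 2 - n on the left produces p_n on the right, and the left side vanishes
      -- because w is in the kernel.
      have h1 := hB.apply_mode_of_quasiPrimary_left hA hε hp hp1 hx (k - 2 - n) w
      rw [hw, sub_sub_cancel, eq_comm, mul_eq_zero, mul_eq_zero] at h1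
      refine h1.resolve_left (not_or.2 ⟨fun h => ?_, zpow_ne_zero _ Complex.I_ne_zero⟩)
      have h2 := koszulSign_mul_self (k : ZMod 2) (l : ZMod 2)
      rw [h, mul_zero] at h2
      exact zero_ne_one h2
    · intro k v _ hv n
      rw [mode_L_neg_one, LinearMap.smul_apply]
      exact Submodule.smul_mem _ _ (hv _)
  exact A.mem_of_weight_le hS u n

/-- For v in J, w'_{-1} v stays in J, where ε vanishes. -/
theorem IsVacuumForm.le_ker {J : Submodule ℂ V} (hJ : A.IsIdeal J) (hJT : J ≠ ⊤) :
    J ≤ LinearMap.ker B := by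
  intro v hv
  rw [LinearMap.mem_ker]
  ext w
  rw [LinearMap.zero_apply, (hB.isSymm hA hε).eq]
  refine A.mem_of_weight_le (S := LinearMap.ker (LinearMap.flip B v)) (fun k w hw => ?_) w
  rw [LinearMap.mem_ker, LinearMap.flip_apply, hB k w hw]
  refine hJ.apply_eq_zero hA hε hJT ?_
  rw [oppositeMode_apply_eq_sum hA hw (-1) (N := k.toNat + 1) (by push_cast; omega)]
  exact J.smul_mem _ (J.sum_mem fun j _ => J.smul_mem _ (hJ.mode_right _ _ _ hv))

/-- A symmetric invariant form that is normalized on the vacuum is the vacuum form. -/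
theorem IsVacuumForm.eq_of_isInvariant {B' : LinearMap.BilinForm ℂ V} (hs : B'.IsSymm)
    (hi : A.IsInvariant B') (h1 : B' A.vacuum A.vacuum = 1) : B' = B := by
  have hcre : ∀ k : ℤ, ∀ u ∈ A.weight k, ∀ w,
      B' u w = B' A.vacuum (A.oppositeMode k u (-1) w) := by
    intro k u hu w
    have h := hi k 0 u A.vacuum w (-1) hu A.vacuum_even
    rwa [A.creation', koszulSign_zero_right, one_mul] at h
  have hvac : ∀ x, B' A.vacuum x = ε x := by
    intro x
    have h := A.mem_of_weight_le (S := LinearMap.ker (B' A.vacuum - ε)) (fun k x hx => ?_) x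
    · simpa [sub_eq_zero] using h
    · rw [LinearMap.mem_ker, LinearMap.sub_apply, sub_eq_zero]
      rcases lt_trichotomy k 0 with hk | rfl | hk
      · rw [hA.weight_neg k hk, Submodule.mem_bot] at hx
        simp [hx]
      · rw [hε.smul_vacuum hA hx]
        simp [h1, hε.vacuum]
      -- By symmetry B'(𝟏, x) = B'(x, 𝟏) = B'(𝟏, x'_{-1}𝟏). The modes in x'_{-1} have index k - j -
      -- 1, which is nonnegative when 2j ≤ k and k > 0, so they annihilate the vacuum.
      · rw [hε.eq_zero k hk.ne' x hx, hs.eq, hcre k x hx,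
          oppositeMode_apply_eq_sum hA hx (-1) (N := k.toNat + 1) (by push_cast; omega),
          Finset.sum_eq_zero, smul_zero, map_zero]
        intro j _
        by_cases hj : k < 2 * j
        · rw [L_one_pow_eq_zero hA hx hj, mode_zero, LinearMap.zero_apply, smul_zero]
        · rw [A.mode_vacuum_of_nonneg _ (by omega), smul_zero]
  ext u w
  have h := A.mem_of_weight_le (S := LinearMap.ker (B' - B)) (fun k u hu => ?_) u
  · have := congrArg (fun f => f w) (LinearMap.mem_ker.1 h)
    simpa [sub_eq_zero] using this
  · rw [LinearMap.mem_ker]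
    ext w
    rw [LinearMap.sub_apply, LinearMap.sub_apply, hcre k u hu, hvac, hB k u hu, sub_self,
      LinearMap.zero_apply]

end

end VertexOperatorSuperalgebra

end

theorem mainTheorem6 {V : Type*} [AddCommGroup V] [Module ℂ V] [Nontrivial V]
    (A : VertexOperatorSuperalgebra V)
    (hA : A.StronglyGenerated ((A.weight 3 ⊔ A.weight 4 : Submodule ℂ V) : Set V)) :
    ∃ B : LinearMap.BilinForm ℂ V,
      (B.IsSymm ∧ A.IsInvariant B ∧ B A.vacuum A.vacuum = 1) ∧
      (∀ B' : LinearMap.BilinForm ℂ V,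
        B'.IsSymm → A.IsInvariant B' → B' A.vacuum A.vacuum = 1 → B' = B) ∧
      A.IsMaximalIdeal (LinearMap.ker B) ∧
      (∀ J : Submodule ℂ V, A.IsMaximalIdeal J → J = LinearMap.ker B) ∧
      (∀ J : Submodule ℂ V, A.IsIdeal J → J ≠ ⊤ → J ≤ LinearMap.ker B) ∧
      A.vacuum ∉ LinearMap.ker B ∧
      (A.IsSimple ↔ B.Nondegenerate) := by
  have hCFT := hA.isCFTType
  obtain ⟨ε, hε⟩ := A.exists_isVacuumFunctional
  obtain ⟨B, hB⟩ := VertexOperatorSuperalgebra.exists_isVacuumForm hCFT ε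
  have hvac : A.vacuum ∉ LinearMap.ker B := fun h => by
    have h1 := hB.apply_vacuum A.vacuum
    rw [LinearMap.mem_ker.1 h, hε.vacuum] at h1
    exact zero_ne_one h1
  have hker := hB.isIdeal_ker hCFT hε
  have hle : ∀ J : Submodule ℂ V, A.IsIdeal J → J ≠ ⊤ → J ≤ LinearMap.ker B :=
    fun J hJ hJT => hB.le_ker hCFT hε hJ hJT
  have hne : LinearMap.ker B ≠ ⊤ := fun h => hvac (h ▸ Submodule.mem_top)
  have hsymm := hB.isSymm hCFT hε
  refine ⟨B, ⟨hsymm, hB.isInvariant hCFT hε, by rw [hB.apply_vacuum, hε.vacuum]⟩,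
    fun B' h1 h2 h3 => hB.eq_of_isInvariant hCFT hε h1 h2 h3,
    ⟨hker, hne, fun K hK hlt => by_contra fun h => hlt.not_ge (hle K hK h)⟩,
    fun J hJ => ?_, hle, hvac, ⟨fun h => ?_, fun h => ⟨inferInstance, fun J hJ => ?_⟩⟩⟩
  · by_contra h
    exact hne (hJ.2.2 _ hker (lt_of_le_of_ne (hle J hJ.1 hJ.2.1) h))
  · have hbot := (h.2 _ hker).resolve_right hne
    have hl : B.SeparatingLeft := LinearMap.separatingLeft_iff_ker_eq_bot.2 hbot
    exact ⟨hl, fun y hy => hl y fun x => by rw [hsymm.eq]; exact hy x⟩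
  · by_cases hJT : J = ⊤
    · exact Or.inr hJT
    · left
      have hbot := LinearMap.separatingLeft_iff_ker_eq_bot.1 h.1
      exact le_bot_iff.1 (hbot ▸ hle J hJ hJT)
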